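/- **Setting.** Let $V$ be a finite set and let $\mathbb P$ be the joint distribution of a family $(X_i)_{i\in V}$ of random variables with values in standard Borel spaces. For $A\subseteq V$ write $X_A=(X_i)_{i\in A}$, and let $X_A\perp X_B\mid X_S$ denote conditional independence under $\mathbb P$. For a directed acyclic graph (DAG) $G=(V,E)$: * $|G|$ is the number of edges of $G$. $pa(j)$ is the set of parents of $j$, and $nd(j)$ is the set of vertices other than $j$ that are not descendants of $j$. $an(S)$ is the set of vertices that are in $S$ or are ancestors of a vertex of $S$. * An undirected path (without repeated vertices) in the skeleton of $G$ from $j$ to $k$ *d-connects* $j$ and $k$ given $S\subseteq V\setminus\{j,k\}$ if every collider on it (an inner vertex into which both path edges point) lies in $an(S)$ and no other inner vertex lies in $S$. If no such path exists, then $j$ and $k$ are *d-separated* given $S$. The *Markov equivalence class* $\mathcal M(G)$ is the set of DAGs on $V$ with the same d-separation relations as $G$. * $(G,\mathbb P)$ satisfies the *Markov condition* if $X_j\perp X_{nd(j)\setminus pa(j)}\mid X_{pa(j)}$ for all $j\in V$. * $\mathbb P$ is *adjacency-faithful* to $G$ if for every edge $j\to k$ and every $S\subseteq V\setminus\{j,k\}$,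 $X_j\perp X_k\mid X_S$ fails. * $\mathbb P$ is *orientation-faithful* to $G$ if for all distinct non-adjacent $j,k$ that have a common neighbour $\ell$ and every $S\subseteq V\setminus\{j,k\}$ given which $j,k$ are d-connected, $X_j\perp X_k\mid X_S$ fails. * *Restricted faithfulness* means adjacency-faithfulness and orientation-faithfulness. * $(G,\mathbb P)$ satisfies the *sparsest Markov representation (SMR) assumption* if it satisfies the Markov condition and $|H|>|G|$ for every DAG $H\notin\mathcal M(G)$ on $V$ such that $(H,\mathbb P)$ satisfies the Markov condition. **Theorem.** (a) If $(G^*,\mathbb P)$ satisfies the Markov condition and restricted faithfulness, then it satisfies the SMR assumption. (b) The converse fails. Let $G^*$ be the DAG on $\{1,2,3,4\}$ with edges $1\to2$, $1\to4$, $2\to3$, $3\to4$. There is a distribution $\mathbb P$ on $\mathbb R^4$, mutually absolutely continuous with Lebesgue measure, such that $(G^*,\mathbb P)$ satisfies the SMR assumption (in particular the Markov condition), while $X_1\perp X_2\mid X_4$, so that adjacency-faithfulness, and hence restricted faithfulness, fails. Moreover, $\mathbb P$ can be chosen so that this is a path cancellation in a linear Gaussian model: $\mathbb P$ is the distribution of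 $X_j=\sum_{k\in pa(j)}w_{kj}X_k+\varepsilon_j$ with all $w_{kj}$ ($k\to j$ an edge of $G^*$) non-zero and with independent centred Gaussian $\varepsilon_j$ of positive variances, and the paths in $G^*$ that d-connect $1$ and $2$ given $\{4\}$ are exactly $1\to2$ and $1\to4\leftarrow3\leftarrow2$. So the SMR assumption is strictly weaker than restricted faithfulness. -/

import Mathlib

open MeasureTheory ProbabilityTheory

/-! ### Directed acyclic graphs -/

/-- A directed acyclic graph on the vertex set `V`. -/
structure DAG (V : Type*) extends Digraph V where
  acyclic : ∀ v, ¬ Relation.TransGen Adj v v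

namespace DAG

variable {V : Type*}

/-- The skeleton: the undirected graph obtained by forgetting the directions of the edges. -/
def skeleton (G : DAG V) : SimpleGraph V := G.toDigraph.toSimpleGraphInclusive

/-- The number of edges `|G|`. -/
noncomputable def numEdges (G : DAG V) : ℕ := Set.ncard {e : V × V | G.Adj e.1 e.2}

/-- The parents of `k`. -/
def parents (G : DAG V) (k : V) : Set V := {j | G.Adj j k}

/-- The descendants of `k`: the endpoints of directed paths with at least one edge out of `k`. -/
def descendants (G : DAG V) (k : V) : Set V := {j | Relation.TransGen G.Adj k j}

/-- The non-descendants of `k`. -/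
def nonDescendants (G : DAG V) (k : V) : Set V := ({k} ∪ G.descendants k)ᶜ

/-- The set `an(S)` of vertices that are in `S` or are ancestors of some vertex in `S`. -/
def ancestors (G : DAG V) (S : Set V) : Set V :=
  {k | k ∈ S ∨ ∃ s ∈ S, Relation.TransGen G.Adj k s}

/-- `(j, k, l)` is an unshielded triple: two distinct non-adjacent vertices `j`, `k`, both
adjacent to `l`. -/
def UnshieldedTriple (G : DAG V) (j k l : V) : Prop :=
  j ≠ k ∧ G.skeleton.Adj j l ∧ G.skeleton.Adj k l ∧ ¬ G.skeleton.Adj j k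

/-- The undirected path `p` d-connects its endpoints given `S`: it visits no vertex twice, every
collider on it is in `an(S)`, and every other inner vertex of it is not in `S`.
The inner vertices of `p` are `p.getVert (i + 1)` with `i + 1 < p.length`. -/
def DConnectsAlong (G : DAG V) (S : Set V) {j k : V} (p : G.skeleton.Walk j k) : Prop :=
  p.IsPath ∧ ∀ i, i + 1 < p.length →
    ((G.Adj (p.getVert i) (p.getVert (i + 1)) ∧ G.Adj (p.getVert (i + 2)) (p.getVert (i + 1)) →
        p.getVert (i + 1) ∈ G.ancestors S) ∧
      (¬ (G.Adj (p.getVert i) (p.getVert (i + 1)) ∧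
          G.Adj (p.getVert (i + 2)) (p.getVert (i + 1))) →
        p.getVert (i + 1) ∉ S))

/-- `j` and `k` are d-connected given `S`. -/
def DConnected (G : DAG V) (j k : V) (S : Set V) : Prop :=
  ∃ p : G.skeleton.Walk j k, G.DConnectsAlong S p

/-- `j` and `k` are d-separated given `S`. -/
def DSeparated (G : DAG V) (j k : V) (S : Set V) : Prop := ¬ G.DConnected j k S

/-- `G` and `H` are Markov equivalent, i.e. `H` is in the Markov equivalence class of `G`: they
encode the same conditional independence relations, i.e. have the same d-separations. -/
def MarkovEquiv (G H : DAG V) : Prop :=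
  ∀ (j k : V) (S : Set V), j ≠ k → j ∉ S → k ∉ S → (G.DSeparated j k S ↔ H.DSeparated j k S)

end DAG

/-! ### Conditional independence and assumptions on a pair of a DAG and a distribution -/

section Distribution

variable {V : Type*} [Finite V] {𝒳 : V → Type*} [∀ i, MeasurableSpace (𝒳 i)]
  [∀ i, StandardBorelSpace (𝒳 i)]

/-- `X_A` and `X_B` are conditionally independent given `X_S`, where `P` is the joint distribution
of the family `(X_i)_{i ∈ V}` and `X_A` is the subfamily `(X_i)_{i ∈ A}`. -/
def CI (P : Measure (∀ i, 𝒳 i)) [IsProbabilityMeasure P] (A B S : Set V) : Prop :=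
  CondIndepFun (MeasurableSpace.comap (S.domRestrict (π := 𝒳)) inferInstance)
    (Set.measurable_restrict S).comap_le (A.domRestrict (π := 𝒳)) (B.domRestrict (π := 𝒳)) P

/-- The (local) Markov condition: each variable is conditionally independent of its
non-descendants other than its parents, given its parents. -/
def Markov (G : DAG V) (P : Measure (∀ i, 𝒳 i)) [IsProbabilityMeasure P] : Prop :=
  ∀ j, CI P {j} (G.nonDescendants j \ G.parents j) (G.parents j)

/-- Adjacency-faithfulness. -/
def AdjacencyFaithful (G : DAG V) (P : Measure (∀ i, 𝒳 i)) [IsProbabilityMeasure P] : Prop :=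
  ∀ j k, G.Adj j k → ∀ S : Set V, j ∉ S → k ∉ S → ¬ CI P {j} {k} S

/-- Orientation-faithfulness. -/
def OrientationFaithful (G : DAG V) (P : Measure (∀ i, 𝒳 i)) [IsProbabilityMeasure P] : Prop :=
  ∀ j k l, G.UnshieldedTriple j k l → ∀ S : Set V, j ∉ S → k ∉ S →
    G.DConnected j k S → ¬ CI P {j} {k} S

/-- The restricted-faithfulness assumption. -/
def RestrictedFaithful (G : DAG V) (P : Measure (∀ i, 𝒳 i)) [IsProbabilityMeasure P] : Prop :=
  AdjacencyFaithful G P ∧ OrientationFaithful G P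

/-- The sparsest Markov representation (SMR) assumption. -/
def SMR (G : DAG V) (P : Measure (∀ i, 𝒳 i)) [IsProbabilityMeasure P] : Prop :=
  Markov G P ∧ ∀ H : DAG V, Markov H P → ¬ G.MarkovEquiv H → G.numEdges < H.numEdges

end Distribution

/-! ### Linear Gaussian models and the four-cycle -/

/-- `P` is the distribution of a linear Gaussian structural equation model on `G` in which no edge
is trivial: `X_j = ∑ k, w k j * X_k + ε_j`, where `w k j ≠ 0` exactly for the edges `k → j`, and
the `ε_j` are independent centred Gaussians of positive variances `σsq j`. -/
def IsLinearGaussianModel {V : Type*} [Fintype V] (G : DAG V) (w : V → V → ℝ) (σsq : V → NNReal)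
    (P : Measure (V → ℝ)) : Prop :=
  (∀ k j, w k j ≠ 0 ↔ G.Adj k j) ∧ (∀ j, 0 < σsq j) ∧
    P.map (fun x j => x j - ∑ k, w k j * x k) = Measure.pi (fun j => gaussianReal 0 (σsq j))

/-- The four-cycle `0 → 1 → 2 → 3`, `0 → 3`. -/
def fourCycle : DAG (Fin 4) where
  Adj j k := (j, k) = (0, 1) ∨ (j, k) = (0, 3) ∨ (j, k) = (1, 2) ∨ (j, k) = (2, 3)
  acyclic v hv := by
    have h : ∀ a b : Fin 4, Relation.TransGen (fun j k : Fin 4 =>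
        (j, k) = (0, 1) ∨ (j, k) = (0, 3) ∨ (j, k) = (1, 2) ∨ (j, k) = (2, 3)) a b → a < b := by
      intro a b hab
      have step : ∀ c d : Fin 4, (c, d) = (0, 1) ∨ (c, d) = (0, 3) ∨ (c, d) = (1, 2) ∨
          (c, d) = (2, 3) → c < d := by decide
      induction hab with
      | single h => exact step _ _ h
      | tail _ h ih => exact ih.trans (step _ _ h)
    exact lt_irrefl v (h v v hv)

namespace DAG

variable {V : Type*} {G H : DAG V} {S : Set V} {j k x y : V}

/-! Part (a). Let `H` be Markov. Of two vertices non-adjacent in `H`, one is a non-descendant of the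
other, so they are independent given the parents of one of them. By adjacency-faithfulness they are
non-adjacent in `G`, hence the skeleton of `G` lies in that of `H`. If the inclusion is strict, `H`
has more edges. If the skeletons agree, orientation-faithfulness makes `G` d-separate the ends of
each unshielded triple given the separating parent set from `H`. Whether that set contains the
middle vertex decides in both graphs whether the triple is a collider, so `G` and `H` have the same
unshielded colliders.

It remains to prove the Verma–Pearl criterion: such DAGs are Markov equivalent
(`SamePattern.markovEquiv`). Following Chickering, `G` is turned into `H` by reversing covered edges
one at a time. Each reversal preserves d-connection; this is checked by simulating active walks edge
by edge, after replacing paths by walks (`dConnected_iff_exists_activeTo`).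

Part (b). In a Gaussian law, independence of two coordinates given others is the vanishing of a
regression residual's covariance, so all such relations of an explicit four-cycle model can be
listed. The cancellation makes 0 and 1 independent given {3} and given no other set. A Markov DAG
that omits the edge 0–1 on that account needs both diagonals, hence five edges; any other with at
most four edges has the skeleton of the four-cycle, and its separating sets force the same
unshielded collider. -/

theorem not_adj_self (G : DAG V) (a : V) : ¬ G.Adj a a := fun h => G.acyclic a (.single h)

theorem ne_of_adj (G : DAG V) {a b : V} (h : G.Adj a b) : a ≠ b := fun e => G.not_adj_self b (e ▸ h)

theorem adj_asymm (G : DAG V) {a b : V} (h : G.Adj a b) : ¬ G.Adj b a :=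
  fun h' => G.acyclic a (.tail (.single h) h')

theorem skeleton_adj {a b : V} : G.skeleton.Adj a b ↔ G.Adj a b ∨ G.Adj b a := by
  have h : G.skeleton.Adj a b ↔ a ≠ b ∧ (G.Adj a b ∨ G.Adj b a) := Iff.rfl
  rw [h]
  exact ⟨fun h => h.2, fun h => ⟨h.elim G.ne_of_adj (fun h => (G.ne_of_adj h).symm), h⟩⟩

@[ext]
theorem ext_adj (h : ∀ a b, G.Adj a b ↔ H.Adj a b) : G = H := by
  rcases G with ⟨⟨g⟩, hg⟩
  rcases H with ⟨⟨f⟩, hf⟩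
  have : g = f := by
    funext a b
    exact propext (h a b)
  subst this
  rfl

/-! ### Active walks -/

/-- `G.ActiveTo S j v d`: there is a walk from `j` to `v`, possibly with repeated vertices, all of
whose inner colliders lie in `an(S)` and all of whose other vertices before `v` avoid `S`. Its last
edge points into `v` if `d = true`, and not if `d = false`. -/
inductive ActiveTo (G : DAG V) (S : Set V) (j : V) : V → Bool → Prop
  | start : ActiveTo G S j j false
  | forward {u v : V} {d : Bool} : ActiveTo G S j u d → G.Adj u v → u ∉ S → ActiveTo G S j v true
  | backward {u v : V} : ActiveTo G S j u false → G.Adj v u → u ∉ S → ActiveTo G S j v false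
  | collider {u v : V} : ActiveTo G S j u true → G.Adj v u → u ∈ G.ancestors S →
      ActiveTo G S j v false

/-- The sequence `v 0, …, v n` is a walk in the skeleton whose inner colliders lie in `an(S)` and
whose other inner vertices avoid `S`. -/
def IsActiveSeq (G : DAG V) (S : Set V) (v : ℕ → V) (n : ℕ) : Prop :=
  (∀ i < n, G.skeleton.Adj (v i) (v (i + 1))) ∧ ∀ i, i + 1 < n →
    (G.Adj (v i) (v (i + 1)) ∧ G.Adj (v (i + 2)) (v (i + 1)) → v (i + 1) ∈ G.ancestors S) ∧
    (¬ (G.Adj (v i) (v (i + 1)) ∧ G.Adj (v (i + 2)) (v (i + 1))) → v (i + 1) ∉ S)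

theorem IsActiveSeq.exists_snoc {v : ℕ → V} {n : ℕ} {w : V} (h : G.IsActiveSeq S v n)
    (hadj : G.skeleton.Adj (v n) w)
    (hinner : ∀ i, i + 1 = n → (G.Adj (v i) (v n) ∧ G.Adj w (v n) → v n ∈ G.ancestors S) ∧
      (¬ (G.Adj (v i) (v n) ∧ G.Adj w (v n)) → v n ∉ S)) :
    ∃ v' : ℕ → V, (∀ i ≤ n, v' i = v i) ∧ v' (n + 1) = w ∧ G.IsActiveSeq S v' (n + 1) := by
  classical
  let v' : ℕ → V := fun i => if i ≤ n then v i else w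
  have h1 : ∀ i ≤ n, v' i = v i := fun i hi => if_pos hi
  have h2 : v' (n + 1) = w := if_neg (by omega)
  refine ⟨v', h1, h2, fun i hi => ?_, fun i hi => ?_⟩
  · rcases Nat.lt_succ_iff_lt_or_eq.1 hi with hi | rfl
    · rw [h1 i hi.le, h1 (i + 1) hi]
      exact h.1 i hi
    · rw [h1 i le_rfl, h2]
      exact hadj
  · rcases Nat.lt_succ_iff_lt_or_eq.1 hi with hi | rfl
    · rw [h1 i (by omega), h1 (i + 1) (by omega), h1 (i + 2) (by omega)]
      exact h.2 i hi
    · rw [h1 i (by omega), h1 (i + 1) le_rfl, h2]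
      exact hinner i rfl

theorem ActiveTo.exists_isActiveSeq {d : Bool} (h : G.ActiveTo S j k d) :
    ∃ (v : ℕ → V) (n : ℕ), v 0 = j ∧ v n = k ∧ G.IsActiveSeq S v n ∧
      ∀ i, i + 1 = n → (d = true ↔ G.Adj (v i) (v n)) := by
  have step : ∀ {u w : V} {d d' : Bool},
      (∃ (v : ℕ → V) (n : ℕ), v 0 = j ∧ v n = u ∧ G.IsActiveSeq S v n ∧
        ∀ i, i + 1 = n → (d = true ↔ G.Adj (v i) (v n))) →
      G.skeleton.Adj u w → (d = true ∧ G.Adj w u → u ∈ G.ancestors S) →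
      (¬ (d = true ∧ G.Adj w u) → u ∉ S) → (d' = true ↔ G.Adj u w) →
      ∃ (v : ℕ → V) (n : ℕ), v 0 = j ∧ v n = w ∧ G.IsActiveSeq S v n ∧
        ∀ i, i + 1 = n → (d' = true ↔ G.Adj (v i) (v n)) := by
    rintro u w d d' ⟨v, n, h0, rfl, hv, hd⟩ huw hc hnc hd'
    obtain ⟨v', h1, h2, h3⟩ := hv.exists_snoc huw fun i hi => by
      rw [← hd i hi]
      exact ⟨hc, hnc⟩
    refine ⟨v', n + 1, by rw [h1 0 (Nat.zero_le _), h0], h2, h3, fun i hi => ?_⟩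
    obtain rfl : i = n := by omega
    rw [h1 i le_rfl, h2]
    exact hd'
  induction h with
  | start => exact ⟨fun _ => j, 0, rfl, rfl, ⟨by simp, by simp⟩, by simp⟩
  | forward _ huv hu ih =>
    exact step ih (skeleton_adj.2 (.inl huv)) (fun h => absurd h.2 (G.adj_asymm huv))
      (fun _ => hu) (by simpa using huv)
  | backward _ hvu hu ih =>
    exact step ih (skeleton_adj.2 (.inr hvu)) (by simp) (fun _ => hu)
      (by simpa using G.adj_asymm hvu)
  | collider _ hvu hu ih =>
    exact step ih (skeleton_adj.2 (.inr hvu)) (fun _ => hu) (fun h => absurd ⟨rfl, hvu⟩ h)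
      (by simpa using G.adj_asymm hvu)

theorem mem_ancestors_of_transGen {a b : V} (h : Relation.TransGen G.Adj a b)
    (hb : b ∈ G.ancestors S) : a ∈ G.ancestors S := by
  rcases hb with hb | ⟨s, hs, hbs⟩
  · exact .inr ⟨b, hb, h⟩
  · exact .inr ⟨s, hs, h.trans hbs⟩

/-- From `v i` the walk stays directed until it first meets an arrow pointing backwards. There it
has a collider in `an(S)`, of which `v i` is an ancestor. -/
theorem IsActiveSeq.mem_ancestors_or {v : ℕ → V} {n i : ℕ} (h : G.IsActiveSeq S v n)
    (hi : G.Adj (v i) (v (i + 1))) (m : ℕ) (hm : i + 1 + m ≤ n) :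
    v i ∈ G.ancestors S ∨
      Relation.TransGen G.Adj (v i) (v (i + 1 + m)) ∧ G.Adj (v (i + m)) (v (i + 1 + m)) := by
  induction m with
  | zero => exact .inr ⟨.single hi, hi⟩
  | succ m ih =>
    rcases ih (by omega) with ih | ⟨ih1, ih2⟩
    · exact .inl ih
    have e : i + 1 + m = i + m + 1 := by omega
    rw [e] at ih1 ih2
    rw [show i + 1 + (m + 1) = i + m + 2 by omega, show i + (m + 1) = i + m + 1 by omega]
    rcases skeleton_adj.1 (h.1 (i + m + 1) (by omega)) with h' | h'
    · exact .inr ⟨ih1.tail h', h'⟩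
    · exact .inl (mem_ancestors_of_transGen ih1 ((h.2 (i + m) (by omega)).1 ⟨ih2, h'⟩))

/-- A closed stretch of an active walk can be cut out. -/
theorem IsActiveSeq.exists_shorter {v : ℕ → V} {n a b : ℕ} (h : G.IsActiveSeq S v n)
    (hab : a < b) (hb : b ≤ n) (heq : v a = v b) :
    ∃ (w : ℕ → V) (m : ℕ), m < n ∧ w 0 = v 0 ∧ w m = v n ∧ G.IsActiveSeq S w m := by
  classical
  let w : ℕ → V := fun i => if i ≤ a then v i else v (i + (b - a))
  have h1 : ∀ i ≤ a, w i = v i := fun i hi => if_pos hi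
  have h2 : ∀ i, a ≤ i → w i = v (i + (b - a)) := fun i hi => by
    rcases hi.eq_or_lt with rfl | hi
    · rw [h1 a le_rfl, heq]
      congr 1
      omega
    · exact if_neg (by omega)
  refine ⟨w, n - (b - a), by omega, h1 0 (Nat.zero_le _), ?_, fun i hi => ?_, fun i hi => ?_⟩
  · rw [h2 _ (by omega)]
    congr 1
    omega
  · rcases lt_or_ge i a with hia | hia
    · rw [h1 i hia.le, h1 (i + 1) hia]
      exact h.1 i (by omega)
    · rw [h2 i hia, h2 (i + 1) (by omega), show i + 1 + (b - a) = i + (b - a) + 1 by omega]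
      exact h.1 _ (by omega)
  · rcases lt_trichotomy (i + 1) a with hia | hia | hia
    · rw [h1 i (by omega), h1 (i + 1) (by omega), h1 (i + 2) (by omega)]
      exact h.2 i (by omega)
    · have e0 := h1 i (by omega)
      have e1 := h1 (i + 1) (by omega)
      have e2 := h2 (i + 2) (by omega)
      rw [show i + 2 + (b - a) = b - 1 + 2 by omega] at e2
      have e3 : v (i + 1) = v (b - 1 + 1) := by
        rw [show b - 1 + 1 = b by omega, ← heq, hia]
      have ha := h.2 i (by omega)
      have hb' := h.2 (b - 1) (by omega)
      rw [← e3] at hb'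
      rw [e0, e1, e2]
      -- Only the junction `v a = v b` changes neighbours. If it becomes a collider without having
      -- been one at `a`, the cut stretch leaves it by an outgoing edge and so either meets a
      -- collider below it or closes a directed cycle. If it becomes a non-collider, it was one
      -- already at `a` or at `b`.
      refine ⟨fun hc => ?_, fun hnc => ?_⟩
      · by_cases hac : G.Adj (v (i + 2)) (v (i + 1))
        · exact ha.1 ⟨hc.1, hac⟩
        have hout : G.Adj (v (i + 1)) (v (i + 1 + 1)) :=
          (skeleton_adj.1 (h.1 (i + 1) (by omega))).resolve_right hac
        rcases h.mem_ancestors_or hout (b - (i + 2)) (by omega) with h' | ⟨h', -⟩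
        · exact h'
        · rw [show i + 1 + 1 + (b - (i + 2)) = b - 1 + 1 by omega, ← e3] at h'
          exact absurd h' (G.acyclic _)
      · by_cases hl : G.Adj (v i) (v (i + 1))
        · exact hb'.2 fun hc => hnc ⟨hl, hc.2⟩
        · exact ha.2 fun hc => hl hc.1
    · rw [h2 i (by omega), h2 (i + 1) (by omega), h2 (i + 2) (by omega),
        show i + 1 + (b - a) = i + (b - a) + 1 by omega,
        show i + 2 + (b - a) = i + (b - a) + 2 by omega]
      exact h.2 _ (by omega)

theorem exists_walk_getVert {W : SimpleGraph V} (v : ℕ → V) (n : ℕ)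
    (h : ∀ i < n, W.Adj (v i) (v (i + 1))) :
    ∃ p : W.Walk (v 0) (v n), p.length = n ∧ ∀ i ≤ n, p.getVert i = v i := by
  induction n generalizing v with
  | zero => exact ⟨.nil, rfl, fun i hi => by simp [Nat.le_zero.1 hi]⟩
  | succ n ih =>
    obtain ⟨p, hp, hpv⟩ := ih (fun i => v (i + 1)) fun i hi => h (i + 1) (by omega)
    refine ⟨.cons (h 0 (by omega)) p, by simp [hp], fun i hi => ?_⟩
    cases i with
    | zero => simp
    | succ i => simpa using hpv i (by omega)

/-- A shortest active walk is a path, since closed stretches can be cut out. The condition on `j`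
enters because `ActiveTo` also tests the start vertex when the walk leaves it. -/
theorem dConnected_iff_exists_activeTo (hj : j ∉ S) :
    G.DConnected j k S ↔ ∃ d, G.ActiveTo S j k d := by
  classical
  constructor
  · rintro ⟨p, -, hp⟩
    have key : ∀ i < p.length, ∃ d, G.ActiveTo S j (p.getVert (i + 1)) d ∧
        (d = true ↔ G.Adj (p.getVert i) (p.getVert (i + 1))) := by
      intro i
      induction i with
      | zero =>
        intro hi
        have h0 := p.adj_getVert_succ hi
        rw [p.getVert_zero] at h0 ⊢
        rcases skeleton_adj.1 h0 with h | h
        · exact ⟨true, .forward .start h hj, by simpa using h⟩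
        · exact ⟨false, .backward .start h hj, by simpa using G.adj_asymm h⟩
      | succ i ih =>
        intro hi
        obtain ⟨d, hd, hd'⟩ := ih (by omega)
        have hpi := hp i hi
        rw [← hd'] at hpi
        rcases skeleton_adj.1 (p.adj_getVert_succ hi) with h | h
        · exact ⟨true, .forward hd h (hpi.2 fun h' => G.adj_asymm h h'.2), by simpa using h⟩
        · refine ⟨false, ?_, by simpa using G.adj_asymm h⟩
          cases d with
          | true => exact .collider hd h (hpi.1 ⟨rfl, h⟩)
          | false => exact .backward hd h (hpi.2 (by simp))
    rcases Nat.eq_zero_or_pos p.length with h0 | h0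
    · obtain rfl := SimpleGraph.Walk.eq_of_length_eq_zero h0
      exact ⟨false, .start⟩
    · obtain ⟨d, hd, -⟩ := key (p.length - 1) (by omega)
      rw [show p.length - 1 + 1 = p.length by omega, p.getVert_length] at hd
      exact ⟨d, hd⟩
  · rintro ⟨d, hd⟩
    have hex : ∃ n, ∃ v : ℕ → V, v 0 = j ∧ v n = k ∧ G.IsActiveSeq S v n := by
      obtain ⟨v, n, h0, hn, hv, -⟩ := hd.exists_isActiveSeq
      exact ⟨n, v, h0, hn, hv⟩
    obtain ⟨n, hfind⟩ : ∃ n, n = Nat.find hex := ⟨_, rfl⟩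
    have hmin : ∀ m < n, ¬ ∃ v : ℕ → V, v 0 = j ∧ v m = k ∧ G.IsActiveSeq S v m :=
      fun m hm => Nat.find_min hex (hfind ▸ hm)
    obtain ⟨v, rfl, rfl, hv⟩ := hfind ▸ Nat.find_spec hex
    obtain ⟨p, hp, hpv⟩ := exists_walk_getVert v n hv.1
    refine ⟨p, ?_, fun i hi => ?_⟩
    · rw [← SimpleGraph.Walk.IsPath.getVert_injOn_iff]
      have key : ∀ a b, a < b → b ≤ n → v a ≠ v b := fun a b hab hb heq => by
        obtain ⟨w, m, hm, hw0, hwm, hw⟩ := hv.exists_shorter hab hb heq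
        exact hmin m hm ⟨w, hw0, hwm, hw⟩
      intro a ha b hb hab
      simp only [Set.mem_ofPred_eq, hp] at ha hb
      rw [hpv a ha, hpv b hb] at hab
      rcases lt_trichotomy a b with h | h | h
      · exact absurd hab (key a b h hb)
      · exact h
      · exact absurd hab.symm (key b a h ha)
    · rw [hp] at hi
      rw [hpv i (by omega), hpv (i + 1) (by omega), hpv (i + 2) (by omega)]
      exact hv.2 i hi

end DAG

namespace DAG

variable {V : Type*} {G H : DAG V} {S : Set V} {j k x y : V}

/-! ### Covered edge reversals -/

/-- `H` arises from `G` by reversing the covered edge `x → y`: the parents of `y` are `x` and the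
parents of `x`. -/
structure IsCoveredReversal (G H : DAG V) (x y : V) : Prop where
  adj : G.Adj x y
  covered : ∀ z, z ≠ x → (G.Adj z y ↔ G.Adj z x)
  adj_iff : ∀ a b, H.Adj a b ↔ (G.Adj a b ∧ ¬ (a = x ∧ b = y)) ∨ (a = y ∧ b = x)

namespace IsCoveredReversal

theorem symm (h : G.IsCoveredReversal H x y) : H.IsCoveredReversal G y x := by
  have hxy := G.ne_of_adj h.adj
  refine ⟨(h.adj_iff y x).2 (.inr ⟨rfl, rfl⟩), fun z hz => ?_, fun a b => ?_⟩
  · by_cases hzx : z = x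
    · subst hzx
      simp [H.not_adj_self, h.adj_iff, hxy]
    · simp [h.adj_iff, hz, hzx, h.covered z hzx]
  · rw [h.adj_iff]
    have h1 := h.adj
    have h2 := G.adj_asymm h1
    grind

theorem adj_of_ne (h : G.IsCoveredReversal H x y) {a b : V} (hab : G.Adj a b)
    (hne : a ≠ x ∨ b ≠ y) : H.Adj a b :=
  (h.adj_iff a b).2 (.inl ⟨hab, by tauto⟩)

theorem skeleton_eq (h : G.IsCoveredReversal H x y) : G.skeleton = H.skeleton := by
  ext a b
  rw [skeleton_adj, skeleton_adj, h.adj_iff, h.adj_iff]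
  have h1 := h.adj
  grind

/-- A directed path using `x → y` and not starting at `x` enters `x` from a parent, which by
coveredness is also a parent of `y`; that edge survives in `H` and bypasses `x`. -/
theorem transGen_or (h : G.IsCoveredReversal H x y) {a b : V} (hab : Relation.TransGen G.Adj a b) :
    a = x ∨ Relation.TransGen H.Adj a b := by
  by_cases hb : b = y
  · subst hb
    induction hab using Relation.TransGen.head_induction_on with
    | @single a hab =>
      by_cases hax : a = x
      · exact .inl hax
      · exact .inr (.single (h.adj_of_ne hab (.inl hax)))
    | @head a c hac hcb ih =>
      by_cases hax : a = x
      · exact .inl hax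
      refine .inr ?_
      rcases ih with rfl | ih
      · exact .single (h.adj_of_ne ((h.covered a hax).2 hac) (.inl hax))
      · exact .head (h.adj_of_ne hac (.inl hax)) ih
  · have key : Relation.TransGen H.Adj a b ∨ (a = x ∧ Relation.TransGen H.Adj y b) := by
      induction hab using Relation.TransGen.head_induction_on with
      | @single a hab => exact .inl (.single (h.adj_of_ne hab (.inr hb)))
      | @head a c hac hcb ih =>
        by_cases hax : a = x
        · by_cases hcy : c = y
          · subst hax hcy
            exact .inr ⟨rfl, ih.resolve_right fun h' => G.ne_of_adj h.adj h'.1.symm⟩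
          · rcases ih with ih | ⟨rfl, ih⟩
            · exact .inl (.head (h.adj_of_ne hac (.inr hcy)) ih)
            · exact absurd (hax ▸ hac) (G.not_adj_self _)
        · rcases ih with ih | ⟨rfl, ih⟩
          · exact .inl (.head (h.adj_of_ne hac (.inl hax)) ih)
          · exact .inl (.head (h.adj_of_ne ((h.covered a hax).2 hac) (.inl hax)) ih)
    tauto

theorem mem_ancestors (h : G.IsCoveredReversal H x y) {a : V} (hax : a ≠ x)
    (ha : a ∈ G.ancestors S) : a ∈ H.ancestors S := by
  rcases ha with ha | ⟨s, hs, has⟩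
  · exact .inl ha
  · exact .inr ⟨s, hs, (h.transGen_or has).resolve_left hax⟩

/-- Only paths out of `x` can be lost, so the first child on the path is still an ancestor of `S`;
the edge to it is lost only if it is `y`. -/
theorem mem_ancestors_or (h : G.IsCoveredReversal H x y)
    (hx : x ∈ G.ancestors S) : x ∈ H.ancestors S ∨ y ∈ H.ancestors S := by
  rcases hx with hx | ⟨s, hs, hxs⟩
  · exact .inl (.inl hx)
  obtain ⟨c, hxc, hcs⟩ := Relation.TransGen.head'_iff.1 hxs
  have hc : c ∈ G.ancestors S := by
    rcases Relation.reflTransGen_iff_eq_or_transGen.1 hcs with rfl | hcs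
    · exact .inl hs
    · exact .inr ⟨s, hs, hcs⟩
  have hcH := h.mem_ancestors (G.ne_of_adj hxc).symm hc
  by_cases hcy : c = y
  · exact .inr (hcy ▸ hcH)
  · exact .inl (mem_ancestors_of_transGen (.single (h.adj_of_ne hxc (.inr hcy))) hcH)

/-- What an active walk of `G` from `j` to `v` yields in the graph `H` where `x → y` is reversed. -/
def Simulates (H : DAG V) (S : Set V) (x y j v : V) (d : Bool) : Prop :=
  (v ≠ x → v ≠ y → H.ActiveTo S j v d) ∧
  (v = y → d = true → (H.ActiveTo S j y true ∧ H.ActiveTo S j x true) ∨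
    (H.ActiveTo S j x false ∧ x ∉ S) ∨ (H.ActiveTo S j y false ∧ H.ActiveTo S j x true ∧
      ∀ b, H.Adj b x → b ≠ y → H.ActiveTo S j b false)) ∧
  (v = y → d = false → H.ActiveTo S j y false) ∧
  (v = x → d = true → H.ActiveTo S j x true ∧ H.ActiveTo S j y true) ∧
  (v = x → d = false → H.ActiveTo S j x false ∨
    (H.ActiveTo S j y true ∨ H.ActiveTo S j y false) ∧ H.ActiveTo S j x true ∧
      ∀ b, H.Adj b x → b ≠ y → H.ActiveTo S j b false)

/-- Every further parent of `x` or `y` is a parent of both, so a walk entering one of them from such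
a parent can enter the other instead. For a walk ending at `x` or `y`, the right counterpart in `H`
depends on how it continues; `Simulates` therefore keeps several walks of `H` ready, some already
one step ahead at the common parents. -/
theorem simulates (h : G.IsCoveredReversal H x y) {v : V} {d : Bool} (hv : G.ActiveTo S j v d) :
    Simulates H S x y j v d := by
  have hxy := G.ne_of_adj h.adj
  have hyx : H.Adj y x := h.symm.adj
  have cov : ∀ b, G.Adj b x → H.Adj b x ∧ H.Adj b y ∧ b ≠ x ∧ b ≠ y := fun b hb => by
    have hbx := G.ne_of_adj hb
    have hby : b ≠ y := by
      rintro rfl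
      exact G.adj_asymm h.adj hb
    exact ⟨h.adj_of_ne hb (.inl hbx), h.adj_of_ne ((h.covered b hbx).2 hb) (.inl hbx), hbx, hby⟩
  have covH : ∀ b, H.Adj b x → b ≠ y → H.Adj b y := fun b hb hby =>
    (h.symm.covered b hby).1 hb
  have adjH : ∀ a b, G.Adj a b → (a ≠ x ∨ b ≠ y) → H.Adj a b := fun a b hab hne =>
    h.adj_of_ne hab hne
  have hf : ∀ u d v, H.ActiveTo S j u d → H.Adj u v → u ∉ S → H.ActiveTo S j v true :=
    fun u d v h1 h2 h3 => .forward h1 h2 h3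
  have hb : ∀ u v, H.ActiveTo S j u false → H.Adj v u → u ∉ S → H.ActiveTo S j v false :=
    fun u v h1 h2 h3 => .backward h1 h2 h3
  have hc : ∀ u v, H.ActiveTo S j u true → H.Adj v u → u ∈ H.ancestors S →
    H.ActiveTo S j v false := fun u v h1 h2 h3 => .collider h1 h2 h3
  have irr : ∀ a, ¬ G.Adj a a := G.not_adj_self
  have hcov := h.covered
  have asymm : ∀ a b, G.Adj a b → ¬ G.Adj b a := fun a b => G.adj_asymm
  have hGxy := h.adj
  induction hv with
  | start =>
    refine ⟨fun _ _ => .start, fun _ h => by simp at h, fun e _ => e ▸ .start,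
      fun _ h => by simp at h, fun e _ => .inl (e ▸ .start)⟩
  | @forward u v d _ huv hu ih =>
    obtain ⟨i1, i2, i3, i4, i5⟩ := ih
    clear h
    cases d <;> refine ⟨?_, ?_, ?_, ?_, ?_⟩ <;> by_cases hux : u = x <;> by_cases huy : u = y <;>
      grind (splits := 20)
  | @backward u v _ hvu hu ih =>
    obtain ⟨i1, i2, i3, i4, i5⟩ := ih
    clear h
    refine ⟨?_, ?_, ?_, ?_, ?_⟩ <;> by_cases hux : u = x <;> by_cases huy : u = y <;>
      grind (splits := 20)
  | @collider u v _ hvu hu ih =>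
    obtain ⟨i1, i2, i3, i4, i5⟩ := ih
    have m1 := fun hux => h.mem_ancestors (a := u) hux hu
    have m2 := fun e : u = x => h.mem_ancestors_or (e ▸ hu)
    clear h
    refine ⟨?_, ?_, ?_, ?_, ?_⟩ <;> by_cases hux : u = x <;> by_cases huy : u = y <;>
      grind (splits := 20)

end IsCoveredReversal

end DAG

namespace DAG

variable {V : Type*} {G H : DAG V} {S : Set V} {j k x y : V}

namespace IsCoveredReversal

theorem exists_activeTo (h : G.IsCoveredReversal H x y) (hG : ∃ d, G.ActiveTo S j k d) :
    ∃ d, H.ActiveTo S j k d := by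
  obtain ⟨d, hd⟩ := hG
  obtain ⟨i1, i2, i3, i4, i5⟩ := h.simulates hd
  have hyx : H.Adj y x := h.symm.adj
  by_cases hkx : k = x
  · subst hkx
    cases d with
    | true => exact ⟨_, (i4 rfl rfl).1⟩
    | false => exact (i5 rfl rfl).elim (fun h => ⟨_, h⟩) fun h => ⟨_, h.2.1⟩
  by_cases hky : k = y
  · subst hky
    cases d with
    | true =>
      rcases i2 rfl rfl with h | h | h
      · exact ⟨_, h.1⟩
      · exact ⟨_, .backward h.1 hyx h.2⟩
      · exact ⟨_, h.1⟩
    | false => exact ⟨_, i3 rfl rfl⟩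
  · exact ⟨_, i1 hkx hky⟩

theorem exists_activeTo_iff (h : G.IsCoveredReversal H x y) :
    (∃ d, G.ActiveTo S j k d) ↔ ∃ d, H.ActiveTo S j k d :=
  ⟨h.exists_activeTo, h.symm.exists_activeTo⟩

end IsCoveredReversal

/-- A covered edge can be reversed without creating a directed cycle. -/
theorem exists_isCoveredReversal (hxy : G.Adj x y)
    (hcov : ∀ z, z ≠ x → (G.Adj z y ↔ G.Adj z x)) : ∃ H : DAG V, G.IsCoveredReversal H x y := by
  let A : V → V → Prop := fun a b => (G.Adj a b ∧ ¬ (a = x ∧ b = y)) ∨ (a = y ∧ b = x)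
  have hne := G.ne_of_adj hxy
  -- Paths of the modified relation translated back to `G`. A path ending at `y` arrives from a
  -- common parent, so it could have ended at `x`. With `a = b`, each alternative yields a cycle of
  -- `G` or a contradiction.
  have key : ∀ a b, Relation.TransGen A a b →
      (b ≠ y ∧ Relation.TransGen G.Adj a b) ∨ (b = y ∧ Relation.TransGen G.Adj a x) ∨
        (a = y ∧ b ≠ y ∧ (b = x ∨ Relation.TransGen G.Adj x b)) := by
    intro a b hab
    induction hab with
    | @single c hac =>
      rcases hac with ⟨hac, hn⟩ | ⟨rfl, rfl⟩
      · by_cases hcy : c = y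
        · subst hcy
          exact .inr (.inl ⟨rfl, .single ((hcov a fun e => hn ⟨e, rfl⟩).1 hac)⟩)
        · exact .inl ⟨hcy, .single hac⟩
      · exact .inr (.inr ⟨rfl, hne, .inl rfl⟩)
    | @tail b c _ hbc ih =>
      rcases hbc with ⟨hbc, hn⟩ | ⟨rfl, rfl⟩
      · by_cases hcy : c = y
        · subst hcy
          have hbx := (hcov b fun e => hn ⟨e, rfl⟩).1 hbc
          rcases ih with ⟨-, ih⟩ | ⟨rfl, -⟩ | ⟨rfl, -, rfl | ih⟩
          · exact .inr (.inl ⟨rfl, ih.tail hbx⟩)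
          · exact absurd hbc (G.not_adj_self _)
          · exact absurd hbx (G.not_adj_self _)
          · exact absurd (ih.tail hbx) (G.acyclic _)
        · rcases ih with ⟨-, ih⟩ | ⟨rfl, ih⟩ | ⟨rfl, -, rfl | ih⟩
          · exact .inl ⟨hcy, ih.tail hbc⟩
          · exact .inl ⟨hcy, (ih.tail hxy).tail hbc⟩
          · exact .inr (.inr ⟨rfl, hcy, .inr (.single hbc)⟩)
          · exact .inr (.inr ⟨rfl, hcy, .inr (ih.tail hbc)⟩)
      · rcases ih with ⟨h, -⟩ | ⟨-, ih⟩ | ⟨-, h, -⟩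
        · exact absurd rfl h
        · exact .inl ⟨hne, ih⟩
        · exact absurd rfl h
  refine ⟨⟨⟨A⟩, fun v hv => ?_⟩, hxy, hcov, fun a b => Iff.rfl⟩
  rcases key v v hv with ⟨-, h⟩ | ⟨rfl, h⟩ | ⟨rfl, h, -⟩
  · exact G.acyclic v h
  · exact G.acyclic _ (h.tail hxy)
  · exact h rfl

/-! ### Markov equivalence from the skeleton and the unshielded colliders -/

/-- `G` and `H` have the same skeleton and the same unshielded colliders. -/
structure SamePattern (G H : DAG V) : Prop where
  skeleton_eq : G.skeleton = H.skeleton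
  collider_iff : ∀ a b l, G.UnshieldedTriple a b l →
    (G.Adj a l ∧ G.Adj b l ↔ H.Adj a l ∧ H.Adj b l)

namespace SamePattern

theorem unshieldedTriple_iff (h : G.SamePattern H) (a b l : V) :
    G.UnshieldedTriple a b l ↔ H.UnshieldedTriple a b l := by
  rw [UnshieldedTriple, UnshieldedTriple, h.skeleton_eq]

theorem symm (h : G.SamePattern H) : H.SamePattern G :=
  ⟨h.skeleton_eq.symm, fun a b l hu =>
    (h.collider_iff a b l ((h.unshieldedTriple_iff a b l).2 hu)).symm⟩

theorem trans {K : DAG V} (h : G.SamePattern H) (h' : H.SamePattern K) : G.SamePattern K :=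
  ⟨h.skeleton_eq.trans h'.skeleton_eq, fun a b l hu => (h.collider_iff a b l hu).trans
    (h'.collider_iff a b l ((h.unshieldedTriple_iff a b l).1 hu))⟩

theorem adj_or (h : G.SamePattern H) {a b : V} (hab : G.Adj a b) : H.Adj a b ∨ H.Adj b a := by
  rw [← skeleton_adj, ← h.skeleton_eq, skeleton_adj]
  exact .inl hab

/-- Two edges of `H` into a common vertex, one of which is reversed in `G`, have adjacent tails. -/
theorem skeleton_adj_of_collider (h : G.SamePattern H) {a b l : V} (ha : H.Adj a l)
    (hb : H.Adj b l) (hab : a ≠ b) (hl : G.Adj l b) : G.skeleton.Adj a b := by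
  by_contra hn
  have hu : H.UnshieldedTriple a b l :=
    ⟨hab, skeleton_adj.2 (.inl ha), skeleton_adj.2 (.inl hb), h.skeleton_eq ▸ hn⟩
  exact G.adj_asymm hl ((h.symm.collider_iff a b l hu).1 ⟨ha, hb⟩).2

end SamePattern

/-- A collider that uses the covered edge, in either direction, is shielded: its other tail is a
parent of both ends. -/
theorem IsCoveredReversal.samePattern (h : G.IsCoveredReversal H x y) : G.SamePattern H := by
  refine ⟨h.skeleton_eq, fun a b l hu => ?_⟩
  obtain ⟨hab, -, -, hn⟩ := hu
  rw [skeleton_adj, not_or] at hn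
  rw [h.adj_iff, h.adj_iff]
  have h1 := h.adj
  have h2 := h.covered
  have h3 := fun a b => @adj_asymm V G a b
  grind

/-- If `G` and `H` have the same pattern and differ, then `G` has a covered edge which is reversed
in `H`. -/
theorem SamePattern.exists_covered [Finite V] (h : G.SamePattern H)
    (hne : ∃ a b, G.Adj a b ∧ H.Adj b a) :
    ∃ x y, G.Adj x y ∧ H.Adj y x ∧ ∀ z, z ≠ x → (G.Adj z y ↔ G.Adj z x) := by
  have : Std.Irrefl (Relation.TransGen G.Adj) := ⟨G.acyclic⟩
  have : IsTrans V (Relation.TransGen G.Adj) := ⟨fun _ _ _ => .trans⟩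
  have wf : WellFounded (Relation.TransGen G.Adj) := Finite.wellFounded_of_trans_of_irrefl _
  have : Std.Irrefl (Function.swap (Relation.TransGen G.Adj)) := ⟨G.acyclic⟩
  have : IsTrans V (Function.swap (Relation.TransGen G.Adj)) := ⟨fun _ _ _ h h' => h'.trans h⟩
  have wf' : WellFounded (Function.swap (Relation.TransGen G.Adj)) :=
    Finite.wellFounded_of_trans_of_irrefl _
  obtain ⟨a, b, hab⟩ := hne
  -- Chickering's choice: `y` is a minimal head of a reversed edge in the ancestral order of `G`,
  -- and then `x` a maximal tail among the reversed edges into `y`. Any failure of coveredness gives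
  -- a mismatched unshielded collider or a directed cycle.
  obtain ⟨y, ⟨x₀, hx₀⟩, hy⟩ := wf.has_min {y | ∃ x, G.Adj x y ∧ H.Adj y x} ⟨b, a, hab⟩
  obtain ⟨x, ⟨hxy, hyx⟩, hx⟩ := wf'.has_min {x | G.Adj x y ∧ H.Adj y x} ⟨x₀, hx₀⟩
  have keep : ∀ z w, Relation.TransGen G.Adj w y → G.Adj z w → H.Adj z w := fun z w hwy hzw =>
    (h.adj_or hzw).resolve_right fun hwz => hy w ⟨z, hzw, hwz⟩ hwy
  refine ⟨x, y, hxy, hyx, fun z hzx => ⟨fun hzy => ?_, fun hz => ?_⟩⟩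
  · by_contra hn
    have hxz : G.Adj x z := by
      by_contra hn'
      have hu : G.UnshieldedTriple z x y := ⟨hzx, skeleton_adj.2 (.inl hzy),
        skeleton_adj.2 (.inl hxy), fun h' => (skeleton_adj.1 h').elim hn hn'⟩
      exact H.adj_asymm hyx ((h.collider_iff z x y hu).1 ⟨hzy, hxy⟩).2
    have hzy' : H.Adj z y :=
      (h.adj_or hzy).resolve_right fun h' => hx z ⟨hzy, h'⟩ (.single hxz)
    exact H.acyclic y (((Relation.TransGen.single hyx).tail
      (keep x z (.single hzy) hxz)).tail hzy')
  · have hzx' := keep z x (.single hxy) hz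
    have hzy : z ≠ y := fun e => G.adj_asymm hxy (e ▸ hz)
    exact (skeleton_adj.1 (h.skeleton_adj_of_collider hzx' hyx hzy hxy)).resolve_right
      fun hyz => G.acyclic y (((Relation.TransGen.single hyz).tail hz).tail hxy)

/-- Induction on the number of edges oriented differently: reversing the edge from `exists_covered`
keeps the pattern and lowers this number. -/
theorem SamePattern.exists_activeTo_iff [Finite V] (h : G.SamePattern H) :
    (∃ d, G.ActiveTo S j k d) ↔ ∃ d, H.ActiveTo S j k d := by
  induction hn : Set.ncard {e : V × V | G.Adj e.1 e.2 ∧ H.Adj e.2 e.1} using Nat.strong_induction_on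
    generalizing G with
  | _ n ih =>
    by_cases hne : ∃ a b, G.Adj a b ∧ H.Adj b a
    · obtain ⟨x, y, hxy, hyx, hcov⟩ := h.exists_covered hne
      obtain ⟨G', hG'⟩ := exists_isCoveredReversal hxy hcov
      refine hG'.exists_activeTo_iff.trans (ih _ ?_ (hG'.symm.samePattern.trans h) rfl)
      rw [← hn]
      refine Set.ncard_lt_ncard ⟨fun e he => ?_, fun hsub => ?_⟩ (Set.toFinite _)
      · rcases (hG'.adj_iff _ _).1 he.1 with h' | ⟨h1, h2⟩
        · exact ⟨h'.1, he.2⟩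
        · exact absurd hyx (H.adj_asymm (h1 ▸ h2 ▸ he.2))
      · have := (hsub (show (x, y) ∈ _ from ⟨hxy, hyx⟩)).1
        exact G'.adj_asymm this hG'.symm.adj
    · suffices G = H by rw [this]
      refine ext_adj fun a b => ⟨fun hab => ?_, fun hab => ?_⟩
      · exact (h.adj_or hab).resolve_right fun h' => hne ⟨a, b, hab, h'⟩
      · exact (h.symm.adj_or hab).resolve_right fun h' => hne ⟨b, a, h', hab⟩

/-- DAGs with the same skeleton and the same unshielded colliders are Markov equivalent. -/
theorem SamePattern.markovEquiv [Finite V] (h : G.SamePattern H) : G.MarkovEquiv H := by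
  intro j k S _ hj _
  rw [DSeparated, DSeparated, dConnected_iff_exists_activeTo hj, dConnected_iff_exists_activeTo hj,
    h.exists_activeTo_iff]

/-! ### Counting edges -/

theorem numEdges_eq (G : DAG V) : G.numEdges = G.skeleton.edgeSet.ncard := by
  have himg : (fun e : V × V => s(e.1, e.2)) '' {e | G.Adj e.1 e.2} = G.skeleton.edgeSet := by
    ext e
    induction e with
    | _ a b =>
      simp only [Set.mem_image, Set.mem_ofPred_eq, Prod.exists, SimpleGraph.mem_edgeSet,
        skeleton_adj, Sym2.eq_iff]
      constructor
      · rintro ⟨c, d, hcd, ⟨rfl, rfl⟩ | ⟨rfl, rfl⟩⟩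
        · exact .inl hcd
        · exact .inr hcd
      · rintro (h | h)
        · exact ⟨a, b, h, .inl ⟨rfl, rfl⟩⟩
        · exact ⟨b, a, h, .inr ⟨rfl, rfl⟩⟩
  rw [← himg, Set.InjOn.ncard_image, numEdges]
  rintro ⟨a, b⟩ hab ⟨c, d⟩ hcd h
  rcases Sym2.eq_iff.1 h with ⟨h1, h2⟩ | ⟨h1, h2⟩
  · exact Prod.ext h1 h2
  · dsimp only at h1 h2
    subst h1 h2
    exact absurd hab (G.adj_asymm hcd)

theorem numEdges_lt_of_skeleton_lt [Finite V] (h : G.skeleton < H.skeleton) :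
    G.numEdges < H.numEdges := by
  rw [numEdges_eq, numEdges_eq]
  exact Set.ncard_lt_ncard (SimpleGraph.edgeSet_strict_mono h) (Set.toFinite _)

theorem mem_nonDescendants {a b : V} :
    a ∈ G.nonDescendants b ↔ a ≠ b ∧ ¬ Relation.TransGen G.Adj b a := by
  simp [nonDescendants, descendants]

theorem notMem_parents_self (G : DAG V) (a : V) : a ∉ G.parents a := G.not_adj_self a

/-- A triple `a - l - b` is d-connecting given `S` if `l` is a collider on it in `an(S)`, or not a
collider and not in `S`. -/
theorem UnshieldedTriple.dConnected {a b l : V} (h : G.UnshieldedTriple a b l)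
    (hS : (G.Adj a l ∧ G.Adj b l → l ∈ G.ancestors S) ∧ (¬ (G.Adj a l ∧ G.Adj b l) → l ∉ S)) :
    G.DConnected a b S := by
  obtain ⟨hab, hal, hbl, -⟩ := h
  refine ⟨.cons hal (.cons hbl.symm .nil), ?_, fun i hi => ?_⟩
  · simp [SimpleGraph.Walk.isPath_def, hab, hal.ne, hbl.ne.symm]
  · obtain rfl : i = 0 := by simpa using hi
    simpa using hS

end DAG

section Distribution

variable {V : Type*} [Finite V] {𝒳 : V → Type*} [∀ i, MeasurableSpace (𝒳 i)]
  [∀ i, StandardBorelSpace (𝒳 i)] {P : Measure (∀ i, 𝒳 i)} [IsProbabilityMeasure P]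
  {A B A' B' S : Set V} {G H : DAG V} {j k : V}

/-! ### Restricted faithfulness implies the SMR assumption -/

theorem CI.symm (h : CI P A B S) : CI P B A S := CondIndepFun.symm h

theorem CI.mono (h : CI P A B S) (hA : A' ⊆ A) (hB : B' ⊆ B) : CI P A' B' S := by
  have hφ : Measurable fun (f : ∀ a : A, 𝒳 a) (a : A') => f ⟨a, hA a.2⟩ :=
    measurable_pi_lambda _ fun _ => measurable_pi_apply _
  have hψ : Measurable fun (f : ∀ b : B, 𝒳 b) (b : B') => f ⟨b, hB b.2⟩ :=
    measurable_pi_lambda _ fun _ => measurable_pi_apply _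
  exact CondIndepFun.comp h hφ hψ

theorem CI.empty_right : CI P A ∅ S := by
  have h : (∅ : Set V).domRestrict (π := 𝒳) = fun _ => fun a => a.2.elim :=
    funext fun _ => funext fun a => a.2.elim
  rw [CI, h]
  exact condIndepFun_const_right _ _

theorem Markov.ci (h : Markov H P) (hjk : j ≠ k) (hadj : ¬ H.Adj k j)
    (hnd : ¬ Relation.TransGen H.Adj j k) : CI P {j} {k} (H.parents j) :=
  (h j).mono subset_rfl
    (Set.singleton_subset_iff.2 ⟨DAG.mem_nonDescendants.2 ⟨hjk.symm, hnd⟩, hadj⟩)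

/-- In a DAG with the Markov condition, two non-adjacent vertices can be named such that they are
independent given the parents of the first, of which the second is not a descendant. -/
theorem Markov.ci_or (h : Markov H P) (hjk : j ≠ k) (hadj : ¬ H.skeleton.Adj j k) :
    (CI P {j} {k} (H.parents j) ∧ k ∉ H.parents j ∧ ¬ Relation.TransGen H.Adj j k) ∨
      (CI P {k} {j} (H.parents k) ∧ j ∉ H.parents k ∧ ¬ Relation.TransGen H.Adj k j) := by
  rw [DAG.skeleton_adj, not_or] at hadj
  by_cases hnd : Relation.TransGen H.Adj j k
  · have hnd' : ¬ Relation.TransGen H.Adj k j := fun h' => H.acyclic j (hnd.trans h')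
    exact .inr ⟨h.ci hjk.symm hadj.1 hnd', hadj.1, hnd'⟩
  · exact .inl ⟨h.ci hjk hadj.2 hnd, hadj.2, hnd⟩

theorem AdjacencyFaithful.skeleton_le (hG : AdjacencyFaithful G P) (hH : Markov H P) :
    G.skeleton ≤ H.skeleton := by
  intro j k hjk
  by_contra hn
  have key : ∀ a b, G.skeleton.Adj a b → CI P {a} {b} (H.parents a) → b ∉ H.parents a → False := by
    intro a b hab hci hb
    rcases DAG.skeleton_adj.1 hab with h | h
    · exact hG a b h _ (H.notMem_parents_self a) hb hci
    · exact hG b a h _ hb (H.notMem_parents_self a) hci.symm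
  rcases hH.ci_or hjk.ne hn with ⟨h1, h2, -⟩ | ⟨h1, h2, -⟩
  · exact key j k hjk h1 h2
  · exact key k j hjk.symm h1 h2

/-- For an unshielded triple `a - l - b` with `b` not below `a` in `H`, the set of parents of `a` in
`H` contains `l` exactly when the triple is not a collider in `H`. As `G` also separates `a` and `b`
given this set, the same holds in `G`. -/
theorem OrientationFaithful.samePattern (hG : OrientationFaithful G P) (hH : Markov H P)
    (hskel : G.skeleton = H.skeleton) : G.SamePattern H := by
  refine ⟨hskel, ?_⟩
  have key : ∀ a b l, G.UnshieldedTriple a b l → CI P {a} {b} (H.parents a) →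
      b ∉ H.parents a → ¬ Relation.TransGen H.Adj a b →
      (G.Adj a l ∧ G.Adj b l ↔ H.Adj a l ∧ H.Adj b l) := by
    intro a b l hu hci hb hnd
    have hsep : ¬ G.DConnected a b (H.parents a) := fun hd =>
      hG a b l hu _ (H.notMem_parents_self a) hb hd hci
    have hal : H.skeleton.Adj a l := hskel ▸ hu.2.1
    have hbl : H.skeleton.Adj b l := hskel ▸ hu.2.2.1
    constructor
    · intro hc
      have hl : l ∉ H.parents a := fun hl =>
        hsep (hu.dConnected ⟨fun _ => .inl hl, fun h => absurd hc h⟩)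
      have hal' := (DAG.skeleton_adj.1 hal).resolve_right hl
      exact ⟨hal', (DAG.skeleton_adj.1 hbl).resolve_right fun h' => hnd (.tail (.single hal') h')⟩
    · rintro ⟨hc, -⟩
      by_contra hn
      exact hsep (hu.dConnected ⟨fun h => absurd h hn, fun _ => H.adj_asymm hc⟩)
  intro a b l hu
  rcases hH.ci_or hu.1 (hskel ▸ hu.2.2.2) with ⟨h1, h2, h3⟩ | ⟨h1, h2, h3⟩
  · exact key a b l hu h1 h2 h3
  · have hu' : G.UnshieldedTriple b a l :=
      ⟨hu.1.symm, hu.2.2.1, hu.2.1, fun h => hu.2.2.2 h.symm⟩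
    rw [and_comm, key b a l hu' h1 h2 h3, and_comm]

theorem RestrictedFaithful.smr (hG : RestrictedFaithful G P) (hM : Markov G P) : SMR G P := by
  refine ⟨hM, fun H hH hne => DAG.numEdges_lt_of_skeleton_lt ?_⟩
  exact (hG.1.skeleton_le hH).lt_of_ne fun h => hne (hG.2.samePattern hH h).markovEquiv

end Distribution

/-! ### Conditional independence with an additive independent noise -/

section AdditiveNoise

variable {Ω γ δ : Type*} [MeasurableSpace Ω] [MeasurableSpace γ] [MeasurableSpace δ]

/-- The law of `h c + Y`, where `Y` has law `ν`, as a kernel in `c`. -/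
noncomputable def shiftKernel (h : γ → ℝ) (ν : Measure ℝ) : Kernel γ ℝ :=
  (Kernel.id ×ₖ Kernel.const γ ν).map fun p => h p.1 + p.2

variable {h : γ → ℝ} {ν : Measure ℝ} [IsProbabilityMeasure ν]

theorem isMarkovKernel_shiftKernel (hh : Measurable h) : IsMarkovKernel (shiftKernel h ν) :=
  Kernel.IsMarkovKernel.map _ (by fun_prop)

theorem shiftKernel_apply (hh : Measurable h) (c : γ) :
    shiftKernel h ν c = ν.map fun y => h c + y := by
  rw [shiftKernel, Kernel.map_apply _ (by fun_prop), Kernel.prod_apply, Kernel.id_apply,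
    Kernel.const_apply, Measure.dirac_prod, Measure.map_map (by fun_prop) (by fun_prop)]
  rfl

theorem compProd_shiftKernel (hh : Measurable h) (μ : Measure γ) [SFinite μ] :
    μ ⊗ₘ shiftKernel h ν = (μ.prod ν).map fun p => (p.1, h p.1 + p.2) := by
  have := isMarkovKernel_shiftKernel (ν := ν) hh
  have hm : Measurable fun p : γ × ℝ => (p.1, h p.1 + p.2) := by fun_prop
  ext s hs
  rw [Measure.compProd_apply hs, Measure.map_apply hm hs, Measure.prod_apply (hm hs)]
  refine lintegral_congr fun c => ?_
  rw [shiftKernel_apply hh, Measure.map_apply (by fun_prop) (measurable_prodMk_left hs)]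
  rfl

variable {P : Measure Ω} [IsProbabilityMeasure P] {Z : Ω → γ} {W : Ω → δ} {Y : Ω → ℝ}

/-- The shear `(c, y) ↦ (c, h c + y)` is invertible and carries the product law to the right-hand
side. -/
theorem map_add_eq_compProd_iff (hh : Measurable h) (hZ : Measurable Z) (hY : Measurable Y) :
    P.map (fun ω => (Z ω, h (Z ω) + Y ω)) = P.map Z ⊗ₘ shiftKernel h (P.map Y) ↔
      IndepFun Z Y P := by
  have := Measure.isProbabilityMeasure_map (μ := P) hY.aemeasurable
  have hm : Measurable fun p : γ × ℝ => (p.1, h p.1 + p.2) := by fun_prop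
  have hm' : Measurable fun p : γ × ℝ => (p.1, p.2 - h p.1) := by fun_prop
  rw [compProd_shiftKernel hh, indepFun_iff_map_prod_eq_prod_map_map hZ.aemeasurable hY.aemeasurable]
  have h1 : P.map (fun ω => (Z ω, h (Z ω) + Y ω)) =
      (P.map fun ω => (Z ω, Y ω)).map fun p => (p.1, h p.1 + p.2) := by
    rw [Measure.map_map hm (by fun_prop)]
    rfl
  rw [h1]
  refine ⟨fun e => ?_, fun e => by rw [e]⟩
  have h2 := congrArg (Measure.map fun p : γ × ℝ => (p.1, p.2 - h p.1)) e
  rw [Measure.map_map hm' hm, Measure.map_map hm' hm] at h2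
  have h3 : (fun p : γ × ℝ => (p.1, p.2 - h p.1)) ∘ (fun p : γ × ℝ => (p.1, h p.1 + p.2)) = id := by
    funext p
    simp
  rwa [h3, Measure.map_id, Measure.map_id] at h2

/-- If `Y` is independent of `Z`, then `h Z + Y` and `W` are conditionally independent given `Z` if
and only if `Y` is independent of `(Z, W)`. -/
theorem condIndepFun_add_iff [StandardBorelSpace Ω] [StandardBorelSpace δ] [Nonempty δ]
    (hh : Measurable h) (hZ : Measurable Z) (hY : Measurable Y) (hW : Measurable W)
    (hZY : IndepFun Z Y P) :
    CondIndepFun (MeasurableSpace.comap Z inferInstance) hZ.comap_le W (fun ω => h (Z ω) + Y ω) P ↔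
      IndepFun (fun ω => (Z ω, W ω)) Y P := by
  have := Measure.isProbabilityMeasure_map (μ := P) hY.aemeasurable
  have := isMarkovKernel_shiftKernel (ν := P.map Y) hh
  have hf : Measurable fun ω => h (Z ω) + Y ω := by fun_prop
  have hh' : Measurable fun p : γ × δ => h p.1 := by fun_prop
  have := isMarkovKernel_shiftKernel (ν := P.map Y) hh'
  -- Conditional independence says that also conditioning on `W` leaves the conditional law of `h Z
  -- + Y` unchanged. Given `Z` alone this law is the shift kernel, so the preceding criterion
  -- applies to `(Z, W)`.
  rw [condIndepFun_iff_condDistrib_prod_ae_eq_prodMkRight hf hW hZ,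
    ← map_add_eq_compProd_iff hh' (hZ.prodMk hW) hY,
    ← condDistrib_ae_eq_iff_measure_eq_compProd _ hf.aemeasurable]
  have h1 : condDistrib (fun ω => h (Z ω) + Y ω) Z P =ᵐ[P.map Z] shiftKernel h (P.map Y) :=
    (condDistrib_ae_eq_iff_measure_eq_compProd _ hf.aemeasurable _).2
      ((map_add_eq_compProd_iff hh hZ hY).2 hZY)
  have h2 : (condDistrib (fun ω => h (Z ω) + Y ω) Z P).prodMkRight δ
      =ᵐ[P.map fun ω => (Z ω, W ω)] shiftKernel (fun p : γ × δ => h p.1) (P.map Y) := by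
    have hfst : P.map Z = (P.map fun ω => (Z ω, W ω)).map Prod.fst := by
      rw [Measure.map_map (by fun_prop) (by fun_prop)]
      rfl
    rw [hfst] at h1
    filter_upwards [ae_of_ae_map measurable_fst.aemeasurable h1] with p hp
    rw [Kernel.prodMkRight_apply, hp, shiftKernel_apply hh, shiftKernel_apply hh']
  exact ⟨fun h => h.trans h2, fun h => h.trans h2.symm⟩

end AdditiveNoise

/-! ### Conditional independence in Gaussian distributions -/

section Gaussian

variable {V : Type*} [Fintype V] {P : Measure (V → ℝ)}
  {j k : V} {S : Set V}

/-- The order is swapped because `condIndepFun_add_iff` has the variable with additive noise second.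
-/
theorem ci_singleton_iff [IsProbabilityMeasure P] : CI P {j} {k} S ↔
    CondIndepFun (MeasurableSpace.comap (S.domRestrict (π := fun _ => ℝ)) inferInstance)
      (Set.measurable_restrict S).comap_le (fun x => x k) (fun x => x j) P := by
  constructor
  · intro h
    have he : ∀ i : V, Measurable fun f : ({i} : Set V) → ℝ => f ⟨i, rfl⟩ :=
      fun i => measurable_pi_apply _
    exact (CondIndepFun.comp h (he j) (he k)).symm
  · intro h
    have he : ∀ i : V, Measurable fun (t : ℝ) (_ : ({i} : Set V)) => t :=
      fun i => measurable_pi_lambda _ fun _ => measurable_id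
    have h' := CondIndepFun.comp h.symm (he j) (he k)
    have e : ∀ i : V, ((fun (t : ℝ) (_ : ({i} : Set V)) => t) ∘ fun x : V → ℝ => x i) =
        Set.domRestrict ({i} : Set V) (π := fun _ => ℝ) := by
      rintro i
      funext x l
      exact congrArg x (show i = l.1 from l.2.symm)
    rw [e, e] at h'
    exact h'

theorem indepFun_domRestrict_of_covariance [IsGaussian P] {T : Set V} {a : V → ℝ}
    (h : ∀ t ∈ T, cov[fun x => x j - ∑ s, a s * x s, fun x => x t; P] = 0) :
    IndepFun (T.domRestrict (π := fun _ => ℝ)) (fun x => x j - ∑ s, a s * x s) P := by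
  have := Fintype.ofFinite T
  -- The residual becomes a family over `Unit` to fit the criterion that jointly Gaussian,
  -- uncorrelated families are independent.
  let L : (V → ℝ) →L[ℝ] (T → ℝ) × (Unit → ℝ) :=
    ContinuousLinearMap.prod (.pi fun i => .proj i.1)
      (.pi fun _ => .proj j - ∑ s, a s • .proj s)
  have hL : HasGaussianLaw (fun x : V → ℝ => ((fun i : T => x i), fun _ : Unit =>
      x j - ∑ s, a s * x s)) P := by
    convert! (IsGaussian.hasGaussianLaw_id (μ := P)).map (F := (T → ℝ) × (Unit → ℝ)) L using 1
    funext x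
    refine Prod.ext rfl (funext fun _ => ?_)
    simp [L]
  have := hL.indepFun_of_covariance_eval (X := fun (i : T) (x : V → ℝ) => x i)
    (Y := fun (_ : Unit) (x : V → ℝ) => x j - ∑ s, a s * x s) fun i _ => by
      rw [covariance_comm]
      exact h i i.2
  exact this.comp (φ := id) (ψ := fun f : Unit → ℝ => f ()) measurable_id (measurable_pi_apply _)

/-- In a Gaussian distribution, `X_j` and `X_k` are conditionally independent given `X_S` if and
only if `X_k` is uncorrelated with the residual of the regression of `X_j` on `X_S`. -/
theorem ci_iff_covariance_eq_zero [IsGaussian P] {a : V → ℝ} (ha : ∀ s ∉ S, a s = 0)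
    (h : ∀ s ∈ S, cov[fun x => x j - ∑ s, a s * x s, fun x => x s; P] = 0) :
    CI P {j} {k} S ↔ cov[fun x => x j - ∑ s, a s * x s, fun x => x k; P] = 0 := by
  classical
  let g : (S → ℝ) → ℝ := fun z => ∑ s, a s * (if hs : s ∈ S then z ⟨s, hs⟩ else 0)
  have hg : Measurable g := by
    refine Finset.measurable_sum _ fun s _ => measurable_const.mul ?_
    by_cases hs : s ∈ S
    · simpa [hs] using measurable_pi_apply _
    · simp [hs]
  have hgS : ∀ x : V → ℝ, g (S.domRestrict (π := fun _ => ℝ) x) = ∑ s, a s * x s := fun x => by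
    refine Finset.sum_congr rfl fun s _ => ?_
    by_cases hs : s ∈ S
    · simp [hs]
    · simp [ha s hs]
  have hY : Measurable fun x : V → ℝ => x j - ∑ s, a s * x s := by fun_prop
  have hadd : (fun x : V → ℝ => x j) = fun x =>
      g (S.domRestrict (π := fun _ => ℝ) x) + (x j - ∑ s, a s * x s) := by
    funext x
    rw [hgS]
    ring
  rw [ci_singleton_iff, hadd, condIndepFun_add_iff hg (Set.measurable_restrict S) hY
    (measurable_pi_apply k) (indepFun_domRestrict_of_covariance h)]
  constructor
  · intro hind
    have hid := IsGaussian.hasGaussianLaw_id (μ := P)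
    have hp : ∀ i, MemLp (fun x : V → ℝ => x i) 2 P := fun i =>
      (hid.map (.proj i)).memLp_two
    refine IndepFun.covariance_eq_zero
      (hind.symm.comp (φ := id) (ψ := Prod.snd) measurable_id measurable_snd) ?_ (hp k)
    exact (hp j).sub (memLp_finsetSum _ fun s _ => (hp s).const_mul (a s))
  · intro hk
    -- The residual is uncorrelated with `X_S` and `X_k`, hence independent of them jointly.
    have hins : ∀ t ∈ insert k S, cov[fun x => x j - ∑ s, a s * x s, fun x => x t; P] = 0 := by
      rintro t (rfl | ht)
      · exact hk
      · exact h t ht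
    have hφ : Measurable fun f : ↥(insert k S) → ℝ =>
        ((fun s : S => f ⟨s, .inr s.2⟩), f ⟨k, .inl rfl⟩) :=
      (measurable_pi_lambda _ fun _ => measurable_pi_apply _).prodMk (measurable_pi_apply _)
    exact (indepFun_domRestrict_of_covariance hins).comp hφ measurable_id

end Gaussian

/-! ### A linear Gaussian model on the four-cycle with a path cancellation -/

theorem absolutelyContinuous_pi {n : ℕ} (μ ν : Fin n → Measure ℝ) [∀ i, SigmaFinite (μ i)]
    [∀ i, SigmaFinite (ν i)] (h : ∀ i, μ i ≪ ν i) : Measure.pi μ ≪ Measure.pi ν := by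
  induction n with
  | zero =>
    rw [Measure.pi_of_empty μ, Measure.pi_of_empty ν]
  | succ n ih =>
    have hprod := Measure.AbsolutelyContinuous.prod (h 0)
      (ih (fun i => μ (Fin.succAbove 0 i)) (fun i => ν (Fin.succAbove 0 i)) fun i => h _)
    have hμ := (measurePreserving_piFinSuccAbove μ 0).symm
    have hν := (measurePreserving_piFinSuccAbove ν 0).symm
    rw [← hμ.map_eq, ← hν.map_eq]
    exact hprod.map (MeasurableEquiv.measurable _)

/-- The coefficients of `X_0, …, X_3` in the noise variables. -/
def cancelMatrix : Matrix (Fin 4) (Fin 4) ℝ := !![1, 0, 0, 0; 1, 1, 0, 0; 1, 1, 1, 0; 3, 1, 1, 1]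

/-- The covariance matrix of `X_0, …, X_3`. -/
def cancelCov : Matrix (Fin 4) (Fin 4) ℝ := !![1, 1, 1, 3; 1, 2, 2, 4; 1, 2, 3, 5; 3, 4, 5, 12]

/-- The edge weights `1` on `0 → 1`, `1 → 2`, `2 → 3` and `2` on `0 → 3`. -/
def cancelWeight : Fin 4 → Fin 4 → ℝ := !![0, 1, 0, 2; 0, 0, 1, 0; 0, 0, 0, 1; 0, 0, 0, 0]

/-- The distribution of `X_0 = ε_0`, `X_1 = X_0 + ε_1`, `X_2 = X_1 + ε_2`,
`X_3 = X_2 + 2 X_0 + ε_3` with independent standard Gaussian noise. -/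
noncomputable def cancelMeasure : Measure (Fin 4 → ℝ) :=
  (Measure.pi fun _ => gaussianReal 0 1).map (Matrix.toLin' cancelMatrix)

theorem measurable_cancelMatrix : Measurable (Matrix.toLin' cancelMatrix) :=
  (LinearMap.continuous_of_finiteDimensional _).measurable

instance : IsProbabilityMeasure cancelMeasure :=
  Measure.isProbabilityMeasure_map measurable_cancelMatrix.aemeasurable

theorem hasGaussianLaw_pi : HasGaussianLaw id (Measure.pi fun _ : Fin 4 => gaussianReal 0 1) := by
  have hind : iIndepFun (fun (i : Fin 4) (x : Fin 4 → ℝ) => x i)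
      (Measure.pi fun _ : Fin 4 => gaussianReal 0 1) :=
    iIndepFun_pi (X := fun _ => id) fun _ => aemeasurable_id
  refine hind.hasGaussianLaw fun i => ⟨?_⟩
  have h := (measurePreserving_eval (fun _ : Fin 4 => gaussianReal 0 1) i).map_eq
  change IsGaussian (Measure.map (Function.eval i) (Measure.pi fun _ : Fin 4 => gaussianReal 0 1))
  rw [h]
  infer_instance

instance : IsGaussian cancelMeasure :=
  (hasGaussianLaw_pi.map (Matrix.toLin' cancelMatrix).toContinuousLinearMap).isGaussian_map

theorem covariance_pi (i l : Fin 4) :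
    cov[fun x => x i, fun x => x l; Measure.pi fun _ : Fin 4 => gaussianReal 0 1] =
      if i = l then 1 else 0 := by
  have hmp := fun i => measurePreserving_eval (fun _ : Fin 4 => gaussianReal 0 1) i
  have hp : ∀ i, MemLp (fun x : Fin 4 → ℝ => x i) 2 (Measure.pi fun _ => gaussianReal 0 1) :=
    fun i => (hasGaussianLaw_pi.map (.proj i)).memLp_two
  split_ifs with h
  · subst h
    rw [covariance_self (measurable_pi_apply i).aemeasurable]
    have := variance_map (X := id) (Y := fun x : Fin 4 → ℝ => x i)
      (μ := Measure.pi fun _ => gaussianReal 0 1) (by fun_prop) (measurable_pi_apply i).aemeasurable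
    rw [show (Measure.pi fun _ : Fin 4 => gaussianReal 0 1).map (fun x : Fin 4 → ℝ => x i) = _ from
      (hmp i).map_eq, variance_id_gaussianReal] at this
    exact this.symm
  · have hind : iIndepFun (fun (i : Fin 4) (x : Fin 4 → ℝ) => x i)
        (Measure.pi fun _ : Fin 4 => gaussianReal 0 1) :=
      iIndepFun_pi (X := fun _ => id) fun _ => aemeasurable_id
    exact (hind.indepFun h).covariance_eq_zero (hp i) (hp l)

theorem covariance_cancelMeasure (i l : Fin 4) :
    cov[fun x => x i, fun x => x l; cancelMeasure] = cancelCov i l := by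
  have hp : ∀ i, MemLp (fun x : Fin 4 → ℝ => x i) 2 (Measure.pi fun _ => gaussianReal 0 1) :=
    fun i => (hasGaussianLaw_pi.map (.proj i)).memLp_two
  have e : ∀ (i : Fin 4) (x : Fin 4 → ℝ), Matrix.toLin' cancelMatrix x i =
      ∑ m, cancelMatrix i m * x m := fun i x => rfl
  rw [cancelMeasure, covariance_map_fun (measurable_pi_apply i).aestronglyMeasurable
    (measurable_pi_apply l).aestronglyMeasurable
    measurable_cancelMatrix.aemeasurable]
  simp_rw [e]
  rw [covariance_fun_sum_fun_sum (fun m => (hp m).const_mul _) (fun m => (hp m).const_mul _)]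
  simp_rw [covariance_const_mul_left, covariance_const_mul_right, covariance_pi]
  fin_cases i <;> fin_cases l <;> simp [Fin.sum_univ_four, cancelMatrix, cancelCov] <;> norm_num

theorem covariance_residual (j t : Fin 4) (a : Fin 4 → ℝ) :
    cov[fun x => x j - ∑ s, a s * x s, fun x => x t; cancelMeasure] =
      cancelCov j t - ∑ s, a s * cancelCov s t := by
  have hp : ∀ i, MemLp (fun x : Fin 4 → ℝ => x i) 2 cancelMeasure := fun i =>
    ((IsGaussian.hasGaussianLaw_id (μ := cancelMeasure)).map (.proj i)).memLp_two
  rw [covariance_fun_sub_left (hp j) (memLp_finsetSum _ fun s _ => (hp s).const_mul (a s)) (hp t),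
    covariance_fun_sum_left (fun s => (hp s).const_mul (a s)) (hp t)]
  simp_rw [covariance_const_mul_left, covariance_cancelMeasure]

theorem ci_cancelMeasure_iff {j k : Fin 4} {S : Set (Fin 4)} (a : Fin 4 → ℝ)
    (ha : ∀ s ∉ S, a s = 0) (h : ∀ s ∈ S, cancelCov j s - ∑ t, a t * cancelCov t s = 0) :
    CI cancelMeasure {j} {k} S ↔ cancelCov j k - ∑ t, a t * cancelCov t k = 0 := by
  rw [ci_iff_covariance_eq_zero ha fun s hs => by rw [covariance_residual, h s hs],
    covariance_residual]

/-- Since the determinant is 1, absolute continuity in both directions can be checked on the noise.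
-/
theorem volume_map_cancelMatrix :
    (volume : Measure (Fin 4 → ℝ)).map (Matrix.toLin' cancelMatrix) = volume := by
  have hdet : cancelMatrix.det = 1 := by
    simp [cancelMatrix, Matrix.det_succ_row_zero, Fin.sum_univ_succ]
  rw [Real.map_matrix_volume_pi_eq_smul_volume_pi (by rw [hdet]; exact one_ne_zero), hdet]
  simp

theorem cancelMeasure_absolutelyContinuous : cancelMeasure ≪ volume := by
  rw [cancelMeasure, ← volume_map_cancelMatrix]
  exact (absolutelyContinuous_pi _ _ fun _ =>
    gaussianReal_absolutelyContinuous 0 one_ne_zero).map measurable_cancelMatrix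

theorem absolutelyContinuous_cancelMeasure : volume ≪ cancelMeasure := by
  rw [cancelMeasure, ← volume_map_cancelMatrix]
  exact (absolutelyContinuous_pi _ _ fun _ =>
    gaussianReal_absolutelyContinuous' 0 one_ne_zero).map measurable_cancelMatrix

theorem isLinearGaussianModel_cancelMeasure :
    IsLinearGaussianModel fourCycle cancelWeight (fun _ => 1) cancelMeasure := by
  refine ⟨fun k j => ?_, fun _ => one_pos, ?_⟩
  · fin_cases k <;> fin_cases j <;> simp [cancelWeight, fourCycle]
  · rw [cancelMeasure, Measure.map_map (by fun_prop) measurable_cancelMatrix]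
    -- Subtracting the parents' contributions inverts `cancelMatrix` and returns the noise.
    convert! Measure.map_id
    funext x j
    have e : ∀ i : Fin 4, Matrix.toLin' cancelMatrix x i = ∑ m, cancelMatrix i m * x m :=
      fun i => rfl
    simp only [Function.comp_apply, e, Fin.sum_univ_four, id]
    fin_cases j <;> simp [cancelMatrix, cancelWeight] <;> ring

/-! ### Conditional independences of the cancelling model -/

section ConditionalIndependences

variable {S : Set (Fin 4)}

/-- Here and below, the cases run over the subsets of the two remaining vertices, and each witness
`a` solves the normal equations for regressing the first variable on `X_S`. -/
theorem not_ci_zero_three (h0 : 0 ∉ S) (h3 : 3 ∉ S) : ¬ CI cancelMeasure {0} {3} S := by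
  have key : ∃ a : Fin 4 → ℝ, (∀ s ∉ S, a s = 0) ∧
      (∀ s ∈ S, cancelCov 0 s - ∑ t, a t * cancelCov t s = 0) ∧
      cancelCov 0 3 - ∑ t, a t * cancelCov t 3 ≠ 0 := by
    by_cases h1 : 1 ∈ S <;> by_cases h2 : 2 ∈ S
    · refine ⟨![0, 1 / 2, 0, 0], ?_⟩
      simp [Fin.forall_fin_succ, Fin.sum_univ_four, cancelCov, *]; norm_num
    · refine ⟨![0, 1 / 2, 0, 0], ?_⟩
      simp [Fin.forall_fin_succ, Fin.sum_univ_four, cancelCov, *]; norm_num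
    · refine ⟨![0, 0, 1 / 3, 0], ?_⟩
      simp [Fin.forall_fin_succ, Fin.sum_univ_four, cancelCov, *]; norm_num
    · refine ⟨![0, 0, 0, 0], ?_⟩
      simp [Fin.forall_fin_succ, Fin.sum_univ_four, cancelCov, *]
  obtain ⟨a, ha, h, hk⟩ := key
  rwa [ci_cancelMeasure_iff a ha h]

theorem not_ci_one_two (h1 : 1 ∉ S) (h2 : 2 ∉ S) : ¬ CI cancelMeasure {1} {2} S := by
  have key : ∃ a : Fin 4 → ℝ, (∀ s ∉ S, a s = 0) ∧
      (∀ s ∈ S, cancelCov 1 s - ∑ t, a t * cancelCov t s = 0) ∧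
      cancelCov 1 2 - ∑ t, a t * cancelCov t 2 ≠ 0 := by
    by_cases h0 : 0 ∈ S <;> by_cases h3 : 3 ∈ S
    · refine ⟨![0, 0, 0, 1 / 3], ?_⟩
      simp [Fin.forall_fin_succ, Fin.sum_univ_four, cancelCov, *]; norm_num
    · refine ⟨![1, 0, 0, 0], ?_⟩
      simp [Fin.forall_fin_succ, Fin.sum_univ_four, cancelCov, *]; norm_num
    · refine ⟨![0, 0, 0, 1 / 3], ?_⟩
      simp [Fin.forall_fin_succ, Fin.sum_univ_four, cancelCov, *]; norm_num
    · refine ⟨![0, 0, 0, 0], ?_⟩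
      simp [Fin.forall_fin_succ, Fin.sum_univ_four, cancelCov, *]
  obtain ⟨a, ha, h, hk⟩ := key
  rwa [ci_cancelMeasure_iff a ha h]

theorem not_ci_two_three (h2 : 2 ∉ S) (h3 : 3 ∉ S) : ¬ CI cancelMeasure {2} {3} S := by
  have key : ∃ a : Fin 4 → ℝ, (∀ s ∉ S, a s = 0) ∧
      (∀ s ∈ S, cancelCov 2 s - ∑ t, a t * cancelCov t s = 0) ∧
      cancelCov 2 3 - ∑ t, a t * cancelCov t 3 ≠ 0 := by
    by_cases h0 : 0 ∈ S <;> by_cases h1 : 1 ∈ S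
    · refine ⟨![0, 1, 0, 0], ?_⟩
      simp [Fin.forall_fin_succ, Fin.sum_univ_four, cancelCov, *]; norm_num
    · refine ⟨![1, 0, 0, 0], ?_⟩
      simp [Fin.forall_fin_succ, Fin.sum_univ_four, cancelCov, *]; norm_num
    · refine ⟨![0, 1, 0, 0], ?_⟩
      simp [Fin.forall_fin_succ, Fin.sum_univ_four, cancelCov, *]; norm_num
    · refine ⟨![0, 0, 0, 0], ?_⟩
      simp [Fin.forall_fin_succ, Fin.sum_univ_four, cancelCov, *]
  obtain ⟨a, ha, h, hk⟩ := key
  rwa [ci_cancelMeasure_iff a ha h]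

/-- Thus `S = {3}`: the cancellation separates this adjacent pair for one set only. -/
theorem mem_of_ci_zero_one (h0 : 0 ∉ S) (h1 : 1 ∉ S) (hci : CI cancelMeasure {0} {1} S) :
    3 ∈ S ∧ 2 ∉ S := by
  by_contra hn
  have key : ∃ a : Fin 4 → ℝ, (∀ s ∉ S, a s = 0) ∧
      (∀ s ∈ S, cancelCov 0 s - ∑ t, a t * cancelCov t s = 0) ∧
      cancelCov 0 1 - ∑ t, a t * cancelCov t 1 ≠ 0 := by
    by_cases h2 : 2 ∈ S <;> by_cases h3 : 3 ∈ S
    · refine ⟨![0, 0, -3 / 11, 4 / 11], ?_⟩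
      simp [Fin.forall_fin_succ, Fin.sum_univ_four, cancelCov, *]; norm_num
    · refine ⟨![0, 0, 1 / 3, 0], ?_⟩
      simp [Fin.forall_fin_succ, Fin.sum_univ_four, cancelCov, *]; norm_num
    · exact absurd ⟨h3, h2⟩ hn
    · refine ⟨![0, 0, 0, 0], ?_⟩
      simp [Fin.forall_fin_succ, Fin.sum_univ_four, cancelCov, *]
  obtain ⟨a, ha, h, hk⟩ := key
  exact hk ((ci_cancelMeasure_iff a ha h).1 hci)

/-- Thus `S = {1}`, the only d-separating set of this non-adjacent pair; for 1 and 3 it is `{0, 2}`.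
-/
theorem mem_of_ci_zero_two (h0 : 0 ∉ S) (h2 : 2 ∉ S) (hci : CI cancelMeasure {0} {2} S) :
    1 ∈ S ∧ 3 ∉ S := by
  by_contra hn
  have key : ∃ a : Fin 4 → ℝ, (∀ s ∉ S, a s = 0) ∧
      (∀ s ∈ S, cancelCov 0 s - ∑ t, a t * cancelCov t s = 0) ∧
      cancelCov 0 2 - ∑ t, a t * cancelCov t 2 ≠ 0 := by
    by_cases h1 : 1 ∈ S <;> by_cases h3 : 3 ∈ S
    · refine ⟨![0, 0, 0, 1 / 4], ?_⟩
      simp [Fin.forall_fin_succ, Fin.sum_univ_four, cancelCov, *]; norm_num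
    · exact absurd ⟨h1, h3⟩ hn
    · refine ⟨![0, 0, 0, 1 / 4], ?_⟩
      simp [Fin.forall_fin_succ, Fin.sum_univ_four, cancelCov, *]; norm_num
    · refine ⟨![0, 0, 0, 0], ?_⟩
      simp [Fin.forall_fin_succ, Fin.sum_univ_four, cancelCov, *]
  obtain ⟨a, ha, h, hk⟩ := key
  exact hk ((ci_cancelMeasure_iff a ha h).1 hci)

theorem mem_of_ci_one_three (h1 : 1 ∉ S) (h3 : 3 ∉ S) (hci : CI cancelMeasure {1} {3} S) :
    0 ∈ S ∧ 2 ∈ S := by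
  by_contra hn
  have key : ∃ a : Fin 4 → ℝ, (∀ s ∉ S, a s = 0) ∧
      (∀ s ∈ S, cancelCov 1 s - ∑ t, a t * cancelCov t s = 0) ∧
      cancelCov 1 3 - ∑ t, a t * cancelCov t 3 ≠ 0 := by
    by_cases h0 : 0 ∈ S <;> by_cases h2 : 2 ∈ S
    · exact absurd ⟨h0, h2⟩ hn
    · refine ⟨![1, 0, 0, 0], ?_⟩
      simp [Fin.forall_fin_succ, Fin.sum_univ_four, cancelCov, *]; norm_num
    · refine ⟨![0, 0, 2 / 3, 0], ?_⟩
      simp [Fin.forall_fin_succ, Fin.sum_univ_four, cancelCov, *]; norm_num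
    · refine ⟨![0, 0, 0, 0], ?_⟩
      simp [Fin.forall_fin_succ, Fin.sum_univ_four, cancelCov, *]
  obtain ⟨a, ha, h, hk⟩ := key
  exact hk ((ci_cancelMeasure_iff a ha h).1 hci)

/-- With weight `w` on `0 → 3` and the other weights 1, the determinant that must vanish is `(w² +
2w + 4) - (1 + w)(2 + w) = 2 - w`, whence the choice `w = 2`. The coefficient is `3 / 12`. -/
theorem ci_zero_one : CI cancelMeasure {0} {1} {3} := by
  rw [ci_cancelMeasure_iff ![0, 0, 0, 1 / 4]] <;>
    simp [Fin.forall_fin_succ, Fin.sum_univ_four, cancelCov] <;> norm_num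

theorem ci_zero_two : CI cancelMeasure {0} {2} {1} := by
  rw [ci_cancelMeasure_iff ![0, 1 / 2, 0, 0]] <;>
    simp [Fin.forall_fin_succ, Fin.sum_univ_four, cancelCov]

theorem ci_one_three : CI cancelMeasure {1} {3} {0, 2} := by
  rw [ci_cancelMeasure_iff ![1 / 2, 0, 1 / 2, 0]] <;>
    simp [Fin.forall_fin_succ, Fin.sum_univ_four, cancelCov] <;> norm_num

end ConditionalIndependences

/-! ### The four-cycle -/

instance : DecidableRel fourCycle.Adj := fun j k =>
  inferInstanceAs (Decidable ((j, k) = (0, 1) ∨ (j, k) = (0, 3) ∨ (j, k) = (1, 2) ∨ (j, k) = (2, 3)))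

/-- Only 2 and 3 have a non-descendant that is not a parent, namely 0 and 1 respectively. -/
theorem markov_fourCycle : Markov fourCycle cancelMeasure := by
  have h01 : fourCycle.Adj 0 1 := by decide
  have h03 : fourCycle.Adj 0 3 := by decide
  have h12 : fourCycle.Adj 1 2 := by decide
  have h23 : fourCycle.Adj 2 3 := by decide
  have hp2 : fourCycle.parents 2 = {1} := by
    ext v
    change fourCycle.Adj v 2 ↔ v = 1
    revert v
    decide
  have hp3 : fourCycle.parents 3 = {0, 2} := by
    ext v
    change fourCycle.Adj v 3 ↔ v = 0 ∨ v = 2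
    revert v
    decide
  have hsub : ∀ (j : Fin 4) (B : Set (Fin 4)),
      (∀ v, v ∉ B → v = j ∨ fourCycle.Adj v j ∨ Relation.TransGen fourCycle.Adj j v) →
      fourCycle.nonDescendants j \ fourCycle.parents j ⊆ B := by
    intro j B h v hv
    by_contra hB
    obtain ⟨h1, h2⟩ := DAG.mem_nonDescendants.1 hv.1
    rcases h v hB with h | h | h
    · exact h1 h
    · exact hv.2 h
    · exact h2 h
  intro j
  fin_cases j
  · refine CI.mono CI.empty_right subset_rfl (hsub 0 ∅ fun v _ => ?_)
    fin_cases v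
    · exact .inl rfl
    · exact .inr (.inr (.single h01))
    · exact .inr (.inr (.tail (.single h01) h12))
    · exact .inr (.inr (.single h03))
  · refine CI.mono CI.empty_right subset_rfl (hsub 1 ∅ fun v _ => ?_)
    fin_cases v
    · exact .inr (.inl h01)
    · exact .inl rfl
    · exact .inr (.inr (.single h12))
    · exact .inr (.inr (.tail (.single h12) h23))
  · change CI cancelMeasure {2} (fourCycle.nonDescendants 2 \ fourCycle.parents 2)
      (fourCycle.parents 2)
    refine CI.mono (hp2 ▸ ci_zero_two.symm) subset_rfl (hsub 2 {0} fun v hv => ?_)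
    fin_cases v
    · exact absurd rfl hv
    · exact .inr (.inl h12)
    · exact .inl rfl
    · exact .inr (.inr (.single h23))
  · change CI cancelMeasure {3} (fourCycle.nonDescendants 3 \ fourCycle.parents 3)
      (fourCycle.parents 3)
    refine CI.mono (hp3 ▸ ci_one_three.symm) subset_rfl (hsub 3 {1} fun v hv => ?_)
    fin_cases v
    · exact .inr (.inl h03)
    · exact absurd rfl hv
    · exact .inr (.inl h23)
    · exact .inl rfl

theorem card_le_numEdges {H : DAG (Fin 4)} (E : Finset (Sym2 (Fin 4)))
    (hE : ∀ e ∈ E, e ∈ H.skeleton.edgeSet) : E.card ≤ H.numEdges := by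
  rw [DAG.numEdges_eq, ← Set.ncard_coe_finset]
  exact Set.ncard_le_ncard hE (Set.toFinite _)

theorem numEdges_fourCycle : fourCycle.numEdges = 4 := by
  have h : {e : Fin 4 × Fin 4 | fourCycle.Adj e.1 e.2} =
      (({(0, 1), (0, 3), (1, 2), (2, 3)} : Finset (Fin 4 × Fin 4)) : Set (Fin 4 × Fin 4)) := by
    ext e
    simp [fourCycle, Prod.ext_iff]
  rw [DAG.numEdges, h, Set.ncard_coe_finset]
  rfl

/-! ### Sparse Markov DAGs of the cancelling model -/

section Markov

variable {H : DAG (Fin 4)}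

theorem Markov.exists_ci (hH : Markov H cancelMeasure) {j k : Fin 4} (hjk : j ≠ k)
    (hadj : ¬ H.skeleton.Adj j k) : ∃ S, j ∉ S ∧ k ∉ S ∧ CI cancelMeasure {j} {k} S := by
  rcases hH.ci_or hjk hadj with ⟨h1, h2, -⟩ | ⟨h1, h2, -⟩
  · exact ⟨_, H.notMem_parents_self j, h2, h1⟩
  · exact ⟨_, h2, H.notMem_parents_self k, h1.symm⟩

/-- Three edges are forced, as their ends are never independent. If 0–1 is missing, the parent set
of 0 or of 1 is exactly `{3}`; this orientation is incompatible with the separating sets of both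
diagonals, so both are present and there are five edges. -/
theorem Markov.fourCycle_skeleton_le (hH : Markov H cancelMeasure) (hcard : H.numEdges ≤ 4) :
    fourCycle.skeleton ≤ H.skeleton := by
  have h03 : H.skeleton.Adj 0 3 := by
    by_contra hn
    obtain ⟨S, h1, h2, h⟩ := hH.exists_ci (by decide) hn
    exact not_ci_zero_three h1 h2 h
  have h12 : H.skeleton.Adj 1 2 := by
    by_contra hn
    obtain ⟨S, h1, h2, h⟩ := hH.exists_ci (by decide) hn
    exact not_ci_one_two h1 h2 h
  have h23 : H.skeleton.Adj 2 3 := by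
    by_contra hn
    obtain ⟨S, h1, h2, h⟩ := hH.exists_ci (by decide) hn
    exact not_ci_two_three h1 h2 h
  have five : H.skeleton.Adj 0 2 → H.skeleton.Adj 1 3 → False := by
    intro h02 h13
    have := card_le_numEdges (H := H) {s(0, 3), s(1, 2), s(2, 3), s(0, 2), s(1, 3)} (by
      simp only [Finset.mem_insert, Finset.mem_singleton]
      rintro e (rfl | rfl | rfl | rfl | rfl) <;> assumption)
    have hc : ({s(0, 3), s(1, 2), s(2, 3), s(0, 2), s(1, 3)} : Finset (Sym2 (Fin 4))).card = 5 := by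
      decide
    omega
  have a12 := DAG.skeleton_adj.1 h12
  have a23 := DAG.skeleton_adj.1 h23
  have h01 : H.skeleton.Adj 0 1 := by
    by_contra hn
    have hn' := hn
    rw [DAG.skeleton_adj, not_or] at hn'
    rcases hH.ci_or (by decide) hn with ⟨hci, h1, hnd⟩ | ⟨hci, h0, hnd⟩
    · obtain ⟨h30, h20⟩ := mem_of_ci_zero_one (H.notMem_parents_self 0) h1 hci
      have h02 : H.skeleton.Adj 0 2 := by
        by_contra hn2
        rcases hH.ci_or (by decide) hn2 with ⟨hci2, h2, -⟩ | ⟨hci2, h2, hnd2⟩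
        · exact h1 (mem_of_ci_zero_two (H.notMem_parents_self 0) h2 hci2).1
        · have := (mem_of_ci_zero_two h2 (H.notMem_parents_self 2) hci2.symm).2
          -- Otherwise `2 → 3 → 0`, although 0 is a non-descendant of 2.
          exact hnd2 (.tail (.single (a23.resolve_right this)) h30)
      refine five h02 ?_
      by_contra hn3
      rcases hH.ci_or (by decide) hn3 with ⟨hci3, h3, -⟩ | ⟨hci3, h3, -⟩
      · exact hn'.1 (mem_of_ci_one_three (H.notMem_parents_self 1) h3 hci3).1
      · exact H.adj_asymm h30
          (mem_of_ci_one_three h3 (H.notMem_parents_self 3) hci3.symm).1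
    · obtain ⟨h31, h21⟩ := mem_of_ci_zero_one h0 (H.notMem_parents_self 1) hci.symm
      have h12' := a12.resolve_right h21
      refine five ?_ (DAG.skeleton_adj.2 (.inr h31))
      by_contra hn2
      rcases hH.ci_or (by decide) hn2 with ⟨hci2, h2, -⟩ | ⟨hci2, h2, -⟩
      · exact hn'.2 (mem_of_ci_zero_two (H.notMem_parents_self 0) h2 hci2).1
      · have := (mem_of_ci_zero_two h2 (H.notMem_parents_self 2) hci2.symm).2
        exact H.acyclic 2 (((Relation.TransGen.single (a23.resolve_right this)).tail h31).tail h12')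
  have edges : ∀ j k, fourCycle.Adj j k → H.skeleton.Adj j k := by
    rintro j k (h | h | h | h) <;> cases h <;> assumption
  intro j k hjk
  rcases DAG.skeleton_adj.1 hjk with h | h
  · exact edges j k h
  · exact (edges k j h).symm

theorem unshieldedTriple_fourCycle {a b l : Fin 4} (h : fourCycle.UnshieldedTriple a b l) :
    ((a = 0 ∧ b = 2 ∨ a = 2 ∧ b = 0) ∧ (l = 1 ∨ l = 3)) ∨
      ((a = 1 ∧ b = 3 ∨ a = 3 ∧ b = 1) ∧ (l = 0 ∨ l = 2)) := by
  obtain ⟨h1, h2, h3, h4⟩ := h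
  rw [DAG.skeleton_adj] at h2 h3 h4
  revert a b l
  decide

/-- The separating set `{1}` of 0 and 2 is a parent set, so an edge leaves 1 and 1 is no collider.
Then `{0, 2}` cannot be the parents of 1, so it is those of 3: the collider is at 3, and 0 and 2 are
none. -/
theorem Markov.fourCycle_samePattern (hH : Markov H cancelMeasure)
    (hskel : fourCycle.skeleton = H.skeleton) : fourCycle.SamePattern H := by
  have n02 : ¬ H.skeleton.Adj 0 2 := by
    rw [← hskel, DAG.skeleton_adj]
    decide
  have n13 : ¬ H.skeleton.Adj 1 3 := by
    rw [← hskel, DAG.skeleton_adj]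
    decide
  have hA : H.Adj 1 0 ∨ H.Adj 1 2 := by
    rcases hH.ci_or (by decide) n02 with ⟨hci, h, -⟩ | ⟨hci, h, -⟩
    · exact .inl (mem_of_ci_zero_two (H.notMem_parents_self 0) h hci).1
    · exact .inr (mem_of_ci_zero_two h (H.notMem_parents_self 2) hci.symm).1
  have hB : H.Adj 0 3 ∧ H.Adj 2 3 := by
    rcases hH.ci_or (by decide) n13 with ⟨hci, h, -⟩ | ⟨hci, h, -⟩
    · obtain ⟨h0, h2⟩ := mem_of_ci_one_three (H.notMem_parents_self 1) h hci
      exact hA.elim (fun h => absurd h0 (H.adj_asymm h)) fun h => absurd h2 (H.adj_asymm h)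
    · exact mem_of_ci_one_three h (H.notMem_parents_self 3) hci.symm
  have h1 : ¬ (H.Adj 0 1 ∧ H.Adj 2 1) := fun h =>
    hA.elim (H.adj_asymm h.1) (H.adj_asymm h.2)
  have h30 : ¬ H.Adj 3 0 := H.adj_asymm hB.1
  have h32 : ¬ H.Adj 3 2 := H.adj_asymm hB.2
  have e03 : fourCycle.Adj 0 3 := by decide
  have e23 : fourCycle.Adj 2 3 := by decide
  have e21 : ¬ fourCycle.Adj 2 1 := by decide
  have e30 : ¬ fourCycle.Adj 3 0 := by decide
  have e32 : ¬ fourCycle.Adj 3 2 := by decide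
  refine ⟨hskel, fun a b l hu => ?_⟩
  rcases unshieldedTriple_fourCycle hu with
    ⟨⟨rfl, rfl⟩ | ⟨rfl, rfl⟩, rfl | rfl⟩ | ⟨⟨rfl, rfl⟩ | ⟨rfl, rfl⟩, rfl | rfl⟩ <;> tauto

end Markov

theorem smr_fourCycle : SMR fourCycle cancelMeasure := by
  refine ⟨markov_fourCycle, fun H hH hne => ?_⟩
  by_contra hle
  rw [numEdges_fourCycle, not_lt] at hle
  rcases (hH.fourCycle_skeleton_le hle).eq_or_lt with h | h
  · exact hne (hH.fourCycle_samePattern h).markovEquiv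
  · have := DAG.numEdges_lt_of_skeleton_lt h
    rw [numEdges_fourCycle] at this
    omega

/-! ### The d-connecting paths from 0 to 1 -/

theorem SimpleGraph.Walk.IsPath.eq_or_exists {V : Type*} {W : SimpleGraph V} {u v : V}
    {p : W.Walk u v} (hp : p.IsPath) :
    (u = v ∧ p.support = [u]) ∨ (u ≠ v ∧ ∃ w, W.Adj u w ∧ ∃ q : W.Walk w v, q.IsPath ∧
      p.support = u :: q.support ∧ u ∉ q.support) := by
  cases p with
  | nil => exact .inl ⟨rfl, rfl⟩
  | cons h q =>
    rw [SimpleGraph.Walk.cons_isPath_iff] at hp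
    exact .inr ⟨fun e => hp.2 (e ▸ q.end_mem_support), _, h, q, hp.1, rfl, hp.2⟩

/-- A cycle has only two paths between 0 and 1, found by peeling off edges. On the longer one 3 is a
collider in the conditioning set and 2 a non-collider outside it. -/
theorem dConnectsAlong_fourCycle_iff (p : fourCycle.skeleton.Walk 0 1) :
    fourCycle.DConnectsAlong {3} p ↔ p.support = [0, 1] ∨ p.support = [0, 3, 2, 1] := by
  have adj : ∀ {u w : Fin 4}, fourCycle.skeleton.Adj u w →
      fourCycle.Adj u w ∨ fourCycle.Adj w u := fun h => DAG.skeleton_adj.1 h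
  constructor
  · rintro ⟨hp, -⟩
    obtain ⟨h, -⟩ | ⟨-, w, hw, q, hq, hs, h0⟩ := hp.eq_or_exists
    · exact absurd h (by decide)
    have hw' : w = 1 ∨ w = 3 := by
      have := adj hw
      clear hs h0 hq q hw
      revert w
      decide
    rw [hs]
    rcases hw' with rfl | rfl
    · obtain ⟨-, h⟩ | ⟨h, -⟩ := hq.eq_or_exists
      · exact .inl (by rw [h])
      · exact absurd rfl h
    obtain ⟨h, -⟩ | ⟨-, x, hx, r, hr, hs', h3⟩ := hq.eq_or_exists
    · exact absurd h (by decide)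
    rw [hs', List.mem_cons, not_or] at h0
    have hx' : x = 2 := by
      have hx0 : x ≠ 0 := fun e => h0.2 (e ▸ r.start_mem_support)
      have := adj hx
      clear hs' h3 hr r h0 hx
      revert x
      decide
    subst hx'
    obtain ⟨h, -⟩ | ⟨-, y, hy, t, ht, hs'', h2⟩ := hr.eq_or_exists
    · exact absurd h (by decide)
    rw [hs'', List.mem_cons, not_or] at h3
    have hy' : y = 1 := by
      have hy0 : y ≠ 3 := fun e => h3.2 (e ▸ t.start_mem_support)
      have := adj hy
      clear hs'' h2 ht t h3 hy
      revert y
      decide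
    subst hy'
    obtain ⟨-, h⟩ | ⟨h, -⟩ := ht.eq_or_exists
    · exact .inr (by rw [hs', hs'', h])
    · exact absurd rfl h
  · intro h
    have hlen := p.length_support
    have hget : ∀ n ≤ p.length, some (p.getVert n) = p.support[n]? := fun n hn =>
      p.getVert_eq_support_getElem? hn
    refine ⟨(SimpleGraph.Walk.isPath_def _).2 ?_, fun i hi => ?_⟩
    · rcases h with h | h <;> rw [h] <;> decide
    · rcases h with h | h <;> simp only [h, List.length_cons, List.length_nil] at hlen hget
      · omega
      · have g0 : p.getVert 0 = 0 := Option.some_inj.1 (hget 0 (by omega))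
        have g1 : p.getVert 1 = 3 := Option.some_inj.1 (hget 1 (by omega))
        have g2 : p.getVert 2 = 2 := Option.some_inj.1 (hget 2 (by omega))
        have g3 : p.getVert 3 = 1 := Option.some_inj.1 (hget 3 (by omega))
        have e23 : fourCycle.Adj 2 3 := by decide
        have e03 : fourCycle.Adj 0 3 := by decide
        have e32 : ¬ fourCycle.Adj 3 2 := by decide
        obtain rfl | rfl : i = 0 ∨ i = 1 := by omega
        · rw [g0, g1, g2]
          exact ⟨fun _ => .inl rfl, fun h => absurd ⟨e03, e23⟩ h⟩
        · rw [g1, g2, g3]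
          exact ⟨fun h => absurd h.1 e32, fun _ => by simp⟩

theorem mainTheorem2 :
    -- (a) restricted faithfulness implies the SMR assumption
    (∀ (V : Type*) [Finite V] (𝒳 : V → Type*) [∀ i, MeasurableSpace (𝒳 i)]
      [∀ i, StandardBorelSpace (𝒳 i)] (G : DAG V) (P : Measure (∀ i, 𝒳 i))
      [IsProbabilityMeasure P], Markov G P → RestrictedFaithful G P → SMR G P) ∧
    -- (b) on the four-cycle, a positive distribution satisfying SMR (hence Markov) but not
    -- restricted faithfulness, through a cancellation of two paths in a linear Gaussian model
    (∃ (w : Fin 4 → Fin 4 → ℝ) (σsq : Fin 4 → NNReal) (P : Measure (Fin 4 → ℝ))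
      (_ : IsProbabilityMeasure P),
      IsLinearGaussianModel fourCycle w σsq P ∧
      P ≪ volume ∧ volume ≪ P ∧
      (∀ p : fourCycle.skeleton.Walk 0 1, fourCycle.DConnectsAlong {3} p ↔
        p.support = [0, 1] ∨ p.support = [0, 3, 2, 1]) ∧
      CI P {0} {1} {3} ∧
      ¬ AdjacencyFaithful fourCycle P ∧
      ¬ RestrictedFaithful fourCycle P ∧
      SMR fourCycle P) := by
  refine ⟨fun V _ 𝒳 _ _ G P _ hM hG => hG.smr hM, cancelWeight, fun _ => 1, cancelMeasure,
    inferInstance, isLinearGaussianModel_cancelMeasure, cancelMeasure_absolutelyContinuous,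
    absolutelyContinuous_cancelMeasure, dConnectsAlong_fourCycle_iff, ci_zero_one, ?_, ?_,
    smr_fourCycle⟩
  all_goals
    have hn : ¬ AdjacencyFaithful fourCycle cancelMeasure := fun h =>
      h 0 1 (by decide) {3} (by simp) (by simp) ci_zero_one
  · exact hn
  · exact fun h => hn h.1
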